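/- Let $F$ be a field of characteristic $0$. A pro-algebraic group over $F$ is an affine group scheme over $F$. For an $F$-linear category $\mathcal{C}$ and a commutative $F$-algebra $\Lambda$, let $\mathcal{C}_\Lambda$ be the category with the same objects (written $C\otimes\Lambda$) and with $\mathrm{Hom}_{\mathcal{C}_\Lambda}(C_1,C_2)=\mathrm{Hom}_{\mathcal{C}}(C_1,C_2)\otimes_F\Lambda$. An ($F$-algebraic) action of a pro-algebraic group $Q$ on $\mathcal{C}$ consists, for every $\Lambda$, of an action of the group $Q(\Lambda)$ on $\mathcal{C}_\Lambda$ by $\Lambda$-linear functors $q\cdot-$, with natural isomorphisms $1\cdot X\cong X$ and $q_2\cdot(q_1\cdot X)\cong(q_2q_1)\cdot X$ satisfying the usual unit and associativity coherences, together with natural coherent identifications $(q\cdot X)\otimes_\Lambda\Lambda'\cong\phi(q)\cdot(X\otimes_\Lambda\Lambda')$ for all $\phi\colon\Lambda\to\Lambda'$, compatible with the former isomorphisms. An equivariant object is a pair $(C,\alpha)$ with $C\in\mathcal{C}$ and isomorphisms $\alpha_q\colon q\cdot(C\otimes\Lambda)\to C\otimes\Lambda$ in $\mathcal{C}_\Lambda$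 for all $\Lambda$ and $q\in Q(\Lambda)$, satisfying the unit and cocycle conditions and compatible with base change along all $\Lambda\to\Lambda'$. Equivariant objects, with the morphisms of $\mathcal{C}$ that commute with all $\alpha_q$, form an $F$-linear category $\mathcal{C}^Q$. Replacing $\mathcal C$ by $\mathcal{C}_\Lambda$ and $F$-algebras by $\Lambda$-algebras one obtains the category $(\mathcal{C}_\Lambda)^{Q_\Lambda}$ of equivariant objects over $\Lambda$, and a canonical functor $(\mathcal{C}^Q)_\Lambda\to(\mathcal{C}_\Lambda)^{Q_\Lambda}$. Let $1\to Q'\to Q\xrightarrow{\pi}Q''\to1$ be a short exact sequence of pro-algebraic groups over $F$ (that is, $\pi$ is faithfully flat with kernel $Q'$), and let $Q$ act on an $F$-linear category $\mathcal{C}$. Then $q\in Q(\Lambda)$ acts on equivariant objects over $\Lambda$ by $q\cdot(C,\alpha)=(q\cdot C,{}^q\alpha)$, where $({}^q\alpha)_{r}\colon r\cdot(q\cdot C)\cong q\cdot(q^{-1}rq\cdot C)\xrightarrow{q\cdot\alpha_{q^{-1}rq}}q\cdot C$ for $r$ in $Q'$. Suppose given an action of $Q''$ on $\mathcal{C}^{Q'}$,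 and denote by $q\cdot_B X:=\pi(q)\cdot X$ the action of $Q$ on $\mathcal{C}^{Q'}$ deduced from it. Suppose given an isomorphism between these two $Q$-actions, i.e. isomorphisms $$\gamma_q\colon q\cdot X\to q\cdot_B X\qquad(q\in Q(\Lambda))$$ of equivariant objects over $\Lambda$, natural in $X\in(\mathcal{C}^{Q'})_\Lambda$ and compatible with the unit isomorphisms, with the multiplication isomorphisms and with base change. Suppose that over $Q'$ it coincides with the canonical trivialization: for $r\in Q'(\Lambda)$ and $X=(C,\alpha)$, the composite $r\cdot X\xrightarrow{\gamma_r}r\cdot_B X=1\cdot X\cong X$ is $\alpha_r$. Then there is a canonical equivalence of $F$-linear categories $$e\colon\mathcal{C}^Q\xrightarrow{\ \sim\ }(\mathcal{C}^{Q'})^{Q''}.$$ Namely, there are an $F$-linear equivalence $e$ and a natural isomorphism $\eta$ from the composite of $e$ with the forgetful functor $(\mathcal{C}^{Q'})^{Q''}\to\mathcal{C}^{Q'}$ to the restriction functor $\mathcal{C}^Q\to\mathcal{C}^{Q'}$, $(C,\alpha)\mapsto(C,\alpha|_{Q'})$, such that, for every $(C,\alpha)\in\mathcal{C}^Q$ with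 image $e(C,\alpha)=(Y,\beta)$, every $\Lambda$ and every $q\in Q(\Lambda)$, the isomorphism $\eta\colon Y\cong(C,\alpha|_{Q'})$ identifies $\alpha_q$ with the composite $q\cdot Y\xrightarrow{\gamma_q}q\cdot_B Y\xrightarrow{\beta_{\pi(q)}}Y$. -/

import Mathlib

open CategoryTheory TensorProduct

universe w v u

noncomputable section

namespace ProAlg

/-! ### Points of pro-algebraic groups

A pro-algebraic group `Q` over a field `F` is an affine group scheme over `F`, given by its
commutative Hopf algebra `A` of functions. -/

/-- The group `Q(Λ)` of `Λ`-points of `Q = Spec A`: algebra homomorphisms `A → Λ`, with the group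
structure (convolution) coming from the Hopf algebra structure of `A`. -/
abbrev Pts (F A Λ : Type*) [Field F] [CommRing A] [HopfAlgebra F A] [CommRing Λ] [Algebra F Λ] :
    Type _ :=
  WithConv (A →ₐ[F] Λ)

section Points

variable {F A B Λ Λ' : Type*} [Field F] [CommRing A] [HopfAlgebra F A] [CommRing B]
  [HopfAlgebra F B] [CommRing Λ] [Algebra F Λ] [CommRing Λ'] [Algebra F Λ']

/-- The group structure of `Q(Λ)`; the inverse of `q` is `q ∘ S` for the antipode `S`. -/
instance Pts.group : Group (Pts F A Λ) where
  inv q := WithConv.toConv (q.ofConv.comp (HopfAlgebra.antipodeAlgHom F A))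
  inv_mul_cancel q := by
    apply WithConv.ext
    ext x
    have h := congrArg q.ofConv (HopfAlgebra.mul_antipode_rTensor_comul_apply (R := F) x)
    rw [AlgHom.commutes] at h
    refine Eq.trans ?_ h
    rw [AlgHom.convMul_apply]
    generalize (Coalgebra.comul (R := F) x) = t
    induction t using TensorProduct.induction_on with
    | zero => simp
    | add s t hs ht => simp only [map_add, hs, ht]
    | tmul y z => simp

/-- The map `Q(Λ) → Q(Λ')` induced by `φ : Λ → Λ'`. -/
def Pts.push (φ : Λ →ₐ[F] Λ') : Pts F A Λ →* Pts F A Λ' where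
  toFun q := WithConv.toConv (φ.comp q.ofConv)
  map_one' := by
    apply WithConv.ext
    ext x
    simp [AlgHom.convOne_def, Algebra.ofId_apply]
  map_mul' q r := by
    apply WithConv.ext
    exact AlgHom.comp_convMul_distrib φ q r

/-- The map `Q₁(Λ) → Q₂(Λ)` induced by the morphism of group schemes
`Q₁ = Spec A → Q₂ = Spec B` with comorphism `f : B → A`. -/
def Pts.pull (f : B →ₐc[F] A) : Pts F A Λ →* Pts F B Λ where
  toFun q := WithConv.toConv (q.ofConv.comp (f : B →ₐ[F] A))
  map_one' := by
    apply WithConv.ext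
    ext x
    simp [AlgHom.convOne_def, Algebra.ofId_apply]
  map_mul' q r := by
    apply WithConv.ext
    exact AlgHom.convMul_comp_bialgHom_distrib q r f

end Points

/-- Short exactness of `1 → Q' → Q → Q'' → 1`, where `Q' = Spec A'`, `Q = Spec A`,
`Q'' = Spec A''` and the two morphisms have comorphisms `i : A → A'` and `p : A'' → A`:
`Q'` is the scheme-theoretic kernel of `Q → Q''` (on points with values in all `F`-algebras)
and `Q → Q''` is faithfully flat. -/
structure IsShortExact {F A' A A'' : Type u} [Field F] [CommRing A'] [HopfAlgebra F A']
    [CommRing A] [HopfAlgebra F A] [CommRing A''] [HopfAlgebra F A'']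
    (i : A →ₐc[F] A') (p : A'' →ₐc[F] A) : Prop where
  injective : ∀ (Λ : Type u) [CommRing Λ] [Algebra F Λ],
    Function.Injective (Pts.pull i : Pts F A' Λ →* Pts F A Λ)
  exact : ∀ (Λ : Type u) [CommRing Λ] [Algebra F Λ] (q : Pts F A Λ),
    (∃ q' : Pts F A' Λ, Pts.pull i q' = q) ↔ Pts.pull p q = 1
  faithfullyFlat : ((p : A'' →ₐ[F] A) : A'' →+* A).FaithfullyFlat

/-! ### Extension of scalars of a linear category -/

/-- The category `C_Λ`: same objects as `C`, and morphisms `Hom(X, Y) ⊗ Λ`. The object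
`X ⊗ Λ` is `⟨X⟩`. -/
@[ext]
structure ScalarExt (F : Type u) (C : Type w) (Λ : Type u) where
  of : C

namespace ScalarExt

variable {F : Type u} [Field F] {C : Type w} [Category.{v} C] [Preadditive C] [Linear F C]
  {Λ : Type u} [CommRing Λ] [Algebra F Λ]

/-- The composition of `C_Λ`: `(a ⊗ f) ≫ (b ⊗ g) = ab ⊗ (f ≫ g)`. -/
def compMap (X Y Z : C) :
    Λ ⊗[F] (X ⟶ Y) →ₗ[F] Λ ⊗[F] (Y ⟶ Z) →ₗ[F] Λ ⊗[F] (X ⟶ Z) :=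
  TensorProduct.map₂ (LinearMap.mul F Λ) (Linear.comp X Y Z)

instance category : Category (ScalarExt F C Λ) where
  Hom X Y := Λ ⊗[F] (X.of ⟶ Y.of)
  id X := (1 : Λ) ⊗ₜ[F] 𝟙 X.of
  comp {X Y Z} f g := compMap X.of Y.of Z.of f g
  id_comp {X Y} f := by
    induction f using TensorProduct.induction_on with
    | zero => simp
    | tmul a f => simp [compMap]
    | add f g hf hg => rw [map_add, hf, hg]
  comp_id {X Y} f := by
    induction f using TensorProduct.induction_on with
    | zero => simp
    | tmul a f => simp [compMap]
    | add f g hf hg => rw [map_add, LinearMap.add_apply, hf, hg]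
  assoc {W X Y Z} f g h := by
    induction f using TensorProduct.induction_on with
    | zero => simp
    | add f f' hf hf' => simp only [map_add, LinearMap.add_apply, hf, hf']
    | tmul a f =>
      induction g using TensorProduct.induction_on with
      | zero => simp
      | add g g' hg hg' => simp only [map_add, LinearMap.add_apply, hg, hg']
      | tmul b g =>
        induction h using TensorProduct.induction_on with
        | zero => simp
        | add h h' hh hh' => simp only [map_add, hh, hh']
        | tmul c h => simp [compMap, mul_assoc]

theorem compMap_add_left {X Y Z : C} (f f' : Λ ⊗[F] (X ⟶ Y)) (g : Λ ⊗[F] (Y ⟶ Z)) :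
    compMap X Y Z (f + f') g = compMap X Y Z f g + compMap X Y Z f' g := by
  rw [map_add, LinearMap.add_apply]

instance preadditive : Preadditive (ScalarExt F C Λ) where
  homGroup X Y := inferInstanceAs (AddCommGroup (Λ ⊗[F] (X.of ⟶ Y.of)))
  add_comp _ _ _ f f' g := compMap_add_left f f' g
  comp_add X Y Z f g g' := (compMap X.of Y.of Z.of f).map_add g g'

theorem compMap_smul_left {X Y Z : C} (r : Λ) (f : Λ ⊗[F] (X ⟶ Y)) (g : Λ ⊗[F] (Y ⟶ Z)) :
    compMap X Y Z (r • f) g = r • compMap X Y Z f g := by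
  induction f using TensorProduct.induction_on with
  | zero => simp
  | add f f' hf hf' => simp only [smul_add, map_add, LinearMap.add_apply, hf, hf']
  | tmul a f =>
    induction g using TensorProduct.induction_on with
    | zero => simp
    | add g g' hg hg' => simp only [map_add, smul_add, hg, hg']
    | tmul b g => simp [compMap, TensorProduct.smul_tmul', mul_assoc]

theorem compMap_smul_right {X Y Z : C} (r : Λ) (f : Λ ⊗[F] (X ⟶ Y)) (g : Λ ⊗[F] (Y ⟶ Z)) :
    compMap X Y Z f (r • g) = r • compMap X Y Z f g := by
  induction f using TensorProduct.induction_on with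
  | zero => simp
  | add f f' hf hf' => simp only [smul_add, map_add, LinearMap.add_apply, hf, hf']
  | tmul a f =>
    induction g using TensorProduct.induction_on with
    | zero => simp
    | add g g' hg hg' => simp only [map_add, smul_add, hg, hg']
    | tmul b g => simp [compMap, TensorProduct.smul_tmul', mul_left_comm]

/-- The `Λ`-linear structure of `C_Λ`. -/
instance linear : Linear Λ (ScalarExt F C Λ) where
  homModule X Y := inferInstanceAs (Module Λ (Λ ⊗[F] (X.of ⟶ Y.of)))
  smul_comp _ _ _ r f g := compMap_smul_left r f g
  comp_smul _ _ _ f r g := compMap_smul_right r f g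

/-- The pure tensor `r ⊗ f` as a morphism `X ⊗ Λ → Y ⊗ Λ`. -/
def tmul {X Y : C} (r : Λ) (f : X ⟶ Y) : (⟨X⟩ : ScalarExt F C Λ) ⟶ ⟨Y⟩ :=
  r ⊗ₜ[F] f

theorem tmul_comp {X Y Z : C} (r s : Λ) (f : X ⟶ Y) (g : Y ⟶ Z) :
    (tmul r f : (⟨X⟩ : ScalarExt F C Λ) ⟶ ⟨Y⟩) ≫ tmul s g = tmul (r * s) (f ≫ g) := by
  change compMap X Y Z (r ⊗ₜ[F] f) (s ⊗ₜ[F] g) = (r * s) ⊗ₜ[F] (f ≫ g)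
  simp [compMap]

theorem tmul_id (X : C) : (tmul 1 (𝟙 X) : (⟨X⟩ : ScalarExt F C Λ) ⟶ ⟨X⟩) = 𝟙 _ := rfl

theorem tmul_add {X Y : C} (r : Λ) (f g : X ⟶ Y) :
    (tmul r (f + g) : (⟨X⟩ : ScalarExt F C Λ) ⟶ ⟨Y⟩) = tmul r f + tmul r g :=
  TensorProduct.tmul_add r f g

theorem tmul_zero {X Y : C} (r : Λ) :
    (tmul r (0 : X ⟶ Y) : (⟨X⟩ : ScalarExt F C Λ) ⟶ ⟨Y⟩) = 0 :=
  TensorProduct.tmul_zero _ r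

theorem tmul_smul {X Y : C} (r : Λ) (c : F) (f : X ⟶ Y) :
    (tmul r (c • f) : (⟨X⟩ : ScalarExt F C Λ) ⟶ ⟨Y⟩) = algebraMap F Λ c • tmul r f := by
  change r ⊗ₜ[F] (c • f) = (algebraMap F Λ c * r) ⊗ₜ[F] f
  rw [← TensorProduct.smul_tmul, Algebra.smul_def]

theorem tmul_eq_smul {X Y : C} (r : Λ) (f : X ⟶ Y) :
    (tmul r f : (⟨X⟩ : ScalarExt F C Λ) ⟶ ⟨Y⟩) = r • tmul 1 f := by
  change r ⊗ₜ[F] f = (r * 1) ⊗ₜ[F] f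
  rw [mul_one]

theorem one_tmul_comp {X Y Z : C} (f : X ⟶ Y) (g : Y ⟶ Z) :
    (tmul 1 (f ≫ g) : (⟨X⟩ : ScalarExt F C Λ) ⟶ ⟨Z⟩) =
      (tmul 1 f : (⟨X⟩ : ScalarExt F C Λ) ⟶ ⟨Y⟩) ≫ tmul 1 g := by
  rw [tmul_comp, one_mul]

@[elab_as_elim]
theorem hom_induction {X Y : ScalarExt F C Λ} {P : (X ⟶ Y) → Prop} (f : X ⟶ Y)
    (h0 : P 0) (ht : ∀ (r : Λ) (g : X.of ⟶ Y.of), P (tmul r g))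
    (ha : ∀ g h : X ⟶ Y, P g → P h → P (g + h)) : P f :=
  TensorProduct.induction_on (motive := P) f h0 ht ha

variable {Λ' : Type u} [CommRing Λ'] [Algebra F Λ']

/-- The transition functor `C_Λ → C_Λ'` induced by `φ : Λ → Λ'`. It sends the object `X ⊗ Λ` to
`X ⊗ Λ'`; this is its action on morphisms, `r ⊗ f ↦ φ r ⊗ f`. -/
def push (φ : Λ →ₐ[F] Λ') {X Y : ScalarExt F C Λ} :
    (X ⟶ Y) →+ ((⟨X.of⟩ : ScalarExt F C Λ') ⟶ ⟨Y.of⟩) :=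
  (TensorProduct.map φ.toLinearMap (LinearMap.id : (X.of ⟶ Y.of) →ₗ[F] _)).toAddMonoidHom

theorem push_tmul (φ : Λ →ₐ[F] Λ') {X Y : C} (r : Λ) (f : X ⟶ Y) :
    push φ (tmul r f : (⟨X⟩ : ScalarExt F C Λ) ⟶ ⟨Y⟩) = tmul (φ r) f := rfl

theorem push_id (φ : Λ →ₐ[F] Λ') (X : ScalarExt F C Λ) :
    push φ (𝟙 X) = 𝟙 (⟨X.of⟩ : ScalarExt F C Λ') :=
  congrArg (fun r => (tmul r (𝟙 X.of) : (⟨X.of⟩ : ScalarExt F C Λ') ⟶ ⟨X.of⟩)) (map_one φ)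

theorem push_comp (φ : Λ →ₐ[F] Λ') {X Y Z : ScalarExt F C Λ} (f : X ⟶ Y) (g : Y ⟶ Z) :
    push φ (f ≫ g) = push φ f ≫ push φ g := by
  induction f using hom_induction with
  | h0 => simp
  | ha f f' hf hf' => simp only [Preadditive.add_comp, map_add, hf, hf']
  | ht r f =>
    induction g using hom_induction with
    | h0 => simp
    | ha g g' hg hg' => simp only [Preadditive.comp_add, map_add, hg, hg']
    | ht s g =>
      have h := tmul_comp (F := F) r s f g
      have h' := tmul_comp (F := F) (φ r) (φ s) f g
      rw [← map_mul φ] at h'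
      exact (congrArg (push φ) h).trans h'.symm

theorem push_smul (φ : Λ →ₐ[F] Λ') {X Y : ScalarExt F C Λ} (r : Λ) (f : X ⟶ Y) :
    push φ (r • f) = φ r • push φ f := by
  induction f using hom_induction with
  | h0 => simp
  | ha f g hf hg => rw [smul_add, map_add, hf, hg, map_add, smul_add]
  | ht s f => exact congrArg (fun t => tmul t f) (map_mul φ r s)

theorem push_algHom_id {X Y : ScalarExt F C Λ} (f : X ⟶ Y) : push (AlgHom.id F Λ) f = f := by
  induction f using hom_induction with
  | h0 => exact map_zero _
  | ha f g hf hg => exact (map_add _ _ _).trans (congrArg₂ (· + ·) hf hg)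
  | ht r f => rfl

theorem push_algHom_comp {Λ'' : Type u} [CommRing Λ''] [Algebra F Λ''] (ψ : Λ' →ₐ[F] Λ'')
    (φ : Λ →ₐ[F] Λ') {X Y : ScalarExt F C Λ} (f : X ⟶ Y) :
    push (ψ.comp φ) f = push ψ (push φ f) := by
  induction f using hom_induction with
  | h0 => simp only [map_zero]
  | ha f g hf hg => rw [map_add, hf, hg, map_add, map_add]
  | ht r f => rfl

/-- The transition functors preserve isomorphisms. -/
@[simps]
def pushIso (φ : Λ →ₐ[F] Λ') {X Y : ScalarExt F C Λ} (f : X ≅ Y) :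
    (⟨X.of⟩ : ScalarExt F C Λ') ≅ ⟨Y.of⟩ where
  hom := push φ f.hom
  inv := push φ f.inv
  hom_inv_id := by rw [← push_comp, f.hom_inv_id, push_id]
  inv_hom_id := by rw [← push_comp, f.inv_hom_id, push_id]

variable {D : Type*} [Category* D] [Preadditive D] [Linear F D]

/-- The functor `C_Λ → D_Λ` induced by an `F`-linear functor `G : C → D`. It sends `X ⊗ Λ` to
`G X ⊗ Λ`; this is its action on morphisms, `r ⊗ f ↦ r ⊗ G f`. -/
def mapHom (G : C ⥤ D) [G.Additive] [G.Linear F] {X Y : ScalarExt F C Λ} :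
    (X ⟶ Y) →ₗ[Λ] ((⟨G.obj X.of⟩ : ScalarExt F D Λ) ⟶ ⟨G.obj Y.of⟩) :=
  (G.mapLinearMap F (X := X.of) (Y := Y.of)).baseChange Λ

theorem mapHom_tmul (G : C ⥤ D) [G.Additive] [G.Linear F] {X Y : C} (r : Λ) (f : X ⟶ Y) :
    mapHom G (tmul r f : (⟨X⟩ : ScalarExt F C Λ) ⟶ ⟨Y⟩) = tmul r (G.map f) := rfl

theorem mapHom_id (G : C ⥤ D) [G.Additive] [G.Linear F] (X : ScalarExt F C Λ) :
    mapHom G (𝟙 X) = 𝟙 (⟨G.obj X.of⟩ : ScalarExt F D Λ) :=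
  congrArg (fun f => tmul (1 : Λ) f) (G.map_id X.of)

theorem mapHom_comp (G : C ⥤ D) [G.Additive] [G.Linear F] {X Y Z : ScalarExt F C Λ}
    (f : X ⟶ Y) (g : Y ⟶ Z) : mapHom G (f ≫ g) = mapHom G f ≫ mapHom G g := by
  induction f using hom_induction with
  | h0 => simp
  | ha f f' hf hf' => simp only [Preadditive.add_comp, map_add, hf, hf']
  | ht r f =>
    induction g using hom_induction with
    | h0 => simp
    | ha g g' hg hg' => simp only [Preadditive.comp_add, map_add, hg, hg']
    | ht s g =>
      have h := tmul_comp (F := F) r s f g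
      have h' := tmul_comp (F := F) r s (G.map f) (G.map g)
      rw [← G.map_comp] at h'
      exact (congrArg (mapHom G) h).trans h'.symm

theorem push_mapHom (G : C ⥤ D) [G.Additive] [G.Linear F] (φ : Λ →ₐ[F] Λ')
    {X Y : ScalarExt F C Λ} (f : X ⟶ Y) :
    push φ (mapHom G f) = mapHom G (push φ f) := by
  induction f using hom_induction with
  | h0 => simp
  | ha f g hf hg => simp only [map_add, hf, hg]
  | ht r f => rfl

end ScalarExt

open ScalarExt

/-! ### Algebraic actions -/

section Action

variable {F : Type u} [Field F] {A : Type u} [CommRing A] [HopfAlgebra F A]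
  {C : Type w} [Category.{v} C] [Preadditive C] [Linear F C]

/-- An `F`-algebraic action of `Q = Spec A` on the `F`-linear category `C`: for each `F`-algebra
`Λ` a `Λ`-linear action of the group `Q(Λ)` on `C_Λ`, compatible with the transition functors
`C_Λ → C_Λ'`.

* `unit` is the isomorphism `1 · X ≅ X` and `mul` is the isomorphism
  `q₂ · (q₁ · X) ≅ (q₂ q₁) · X`. The unit and the products are given names subject to an equation
  (`q = 1`, `q₂ * q₁ = q`), so that no transport along equalities of points is needed.
* `bc` is the identification `(q · X) ⊗_Λ Λ' ≅ φ(q) · (X ⊗_Λ Λ')`, which is natural and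
  compatible with composition of algebra homomorphisms, with `unit` and with `mul`. A strictly
  commuting square of functors is the case where `bc` is the identity. -/
structure AlgAction (F : Type u) [Field F] (A : Type u) [CommRing A] [HopfAlgebra F A]
    (C : Type w) [Category.{v} C] [Preadditive C] [Linear F C] where
  /-- the functor `q · -` on `C_Λ` -/
  act : ∀ {Λ : Type u} [CommRing Λ] [Algebra F Λ] (_ : Pts F A Λ),
    ScalarExt F C Λ ⥤ ScalarExt F C Λ
  additive : ∀ {Λ : Type u} [CommRing Λ] [Algebra F Λ] (q : Pts F A Λ), (act q).Additive
  linear : ∀ {Λ : Type u} [CommRing Λ] [Algebra F Λ] (q : Pts F A Λ), (act q).Linear Λ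
  unit : ∀ {Λ : Type u} [CommRing Λ] [Algebra F Λ] (q : Pts F A Λ) (_ : q = 1),
    act q ≅ 𝟭 (ScalarExt F C Λ)
  mul : ∀ {Λ : Type u} [CommRing Λ] [Algebra F Λ] (q₂ q₁ q : Pts F A Λ) (_ : q₂ * q₁ = q),
    act q₁ ⋙ act q₂ ≅ act q
  unit_mul : ∀ {Λ : Type u} [CommRing Λ] [Algebra F Λ] (e q : Pts F A Λ) (he : e = 1)
    (h : e * q = q) (X : ScalarExt F C Λ),
    (mul e q q h).hom.app X = (unit e he).hom.app ((act q).obj X)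
  mul_unit : ∀ {Λ : Type u} [CommRing Λ] [Algebra F Λ] (e q : Pts F A Λ) (he : e = 1)
    (h : q * e = q) (X : ScalarExt F C Λ),
    (mul q e q h).hom.app X = (act q).map ((unit e he).hom.app X)
  assoc : ∀ {Λ : Type u} [CommRing Λ] [Algebra F Λ] (q₃ q₂ q₁ q₃₂ q₂₁ q : Pts F A Λ)
    (h₃₂ : q₃ * q₂ = q₃₂) (h₂₁ : q₂ * q₁ = q₂₁) (h : q₃ * q₂₁ = q) (h' : q₃₂ * q₁ = q)
    (X : ScalarExt F C Λ),
    (act q₃).map ((mul q₂ q₁ q₂₁ h₂₁).hom.app X) ≫ (mul q₃ q₂₁ q h).hom.app X =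
      (mul q₃ q₂ q₃₂ h₃₂).hom.app ((act q₁).obj X) ≫ (mul q₃₂ q₁ q h').hom.app X
  bc : ∀ {Λ Λ' : Type u} [CommRing Λ] [Algebra F Λ] [CommRing Λ'] [Algebra F Λ']
    (φ : Λ →ₐ[F] Λ') (q : Pts F A Λ) (X : ScalarExt F C Λ),
    (⟨((act q).obj X).of⟩ : ScalarExt F C Λ') ≅ (act (Pts.push φ q)).obj ⟨X.of⟩
  bc_natural : ∀ {Λ Λ' : Type u} [CommRing Λ] [Algebra F Λ] [CommRing Λ'] [Algebra F Λ']
    (φ : Λ →ₐ[F] Λ') (q : Pts F A Λ) {X Y : ScalarExt F C Λ} (f : X ⟶ Y),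
    push φ ((act q).map f) ≫ (bc φ q Y).hom =
      (bc φ q X).hom ≫ (act (Pts.push φ q)).map (push φ f)
  bc_comp : ∀ {Λ Λ' Λ'' : Type u} [CommRing Λ] [Algebra F Λ] [CommRing Λ'] [Algebra F Λ']
    [CommRing Λ''] [Algebra F Λ''] (φ : Λ →ₐ[F] Λ') (ψ : Λ' →ₐ[F] Λ'') (q : Pts F A Λ)
    (X : ScalarExt F C Λ),
    (bc (ψ.comp φ) q X).hom =
      push ψ (bc φ q X).hom ≫ (bc ψ (Pts.push φ q) ⟨X.of⟩).hom
  bc_unit : ∀ {Λ Λ' : Type u} [CommRing Λ] [Algebra F Λ] [CommRing Λ'] [Algebra F Λ']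
    (φ : Λ →ₐ[F] Λ') (q : Pts F A Λ) (h : q = 1) (h' : Pts.push φ q = 1)
    (X : ScalarExt F C Λ),
    push φ ((unit q h).hom.app X) =
      (bc φ q X).hom ≫ (unit (Pts.push φ q) h').hom.app ⟨X.of⟩
  bc_mul : ∀ {Λ Λ' : Type u} [CommRing Λ] [Algebra F Λ] [CommRing Λ'] [Algebra F Λ']
    (φ : Λ →ₐ[F] Λ') (q₂ q₁ q : Pts F A Λ) (h : q₂ * q₁ = q)
    (h' : Pts.push φ q₂ * Pts.push φ q₁ = Pts.push φ q) (X : ScalarExt F C Λ),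
    push φ ((mul q₂ q₁ q h).hom.app X) ≫ (bc φ q X).hom =
      (bc φ q₂ ((act q₁).obj X)).hom ≫ (act (Pts.push φ q₂)).map (bc φ q₁ X).hom ≫
        (mul (Pts.push φ q₂) (Pts.push φ q₁) (Pts.push φ q) h').hom.app ⟨X.of⟩

attribute [instance] AlgAction.additive AlgAction.linear

theorem Pts.push_pull {B : Type u} [CommRing B] [HopfAlgebra F B] {Λ Λ' : Type u} [CommRing Λ]
    [Algebra F Λ] [CommRing Λ'] [Algebra F Λ'] (φ : Λ →ₐ[F] Λ') (f : B →ₐc[F] A)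
    (q : Pts F A Λ) : Pts.push φ (Pts.pull f q) = Pts.pull f (Pts.push φ q) := rfl

/-- The action of `Q₁ = Spec A` deduced from an action of `Q₂ = Spec B` via the morphism
`Q₁ → Q₂` with comorphism `f : B → A`. -/
abbrev AlgAction.res {B : Type u} [CommRing B] [HopfAlgebra F B] (b : AlgAction F B C)
    (f : B →ₐc[F] A) : AlgAction F A C where
  act q := b.act (Pts.pull f q)
  additive q := b.additive _
  linear q := b.linear _
  unit q h := b.unit (Pts.pull f q) (by rw [h, map_one])
  mul q₂ q₁ q h := b.mul (Pts.pull f q₂) (Pts.pull f q₁) (Pts.pull f q) (by rw [← h, map_mul])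
  unit_mul _ _ _ _ X := b.unit_mul _ _ _ _ X
  mul_unit _ _ _ _ X := b.mul_unit _ _ _ _ X
  assoc _ _ _ _ _ _ _ _ _ _ X := b.assoc _ _ _ _ _ _ _ _ _ _ X
  bc φ q X := b.bc φ (Pts.pull f q) X
  bc_natural φ q _ _ g := b.bc_natural φ (Pts.pull f q) g
  bc_comp φ ψ q X := b.bc_comp φ ψ (Pts.pull f q) X
  bc_unit φ q h _ X := b.bc_unit φ (Pts.pull f q) (by rw [h, map_one])
    (by rw [h, map_one, map_one]) X
  bc_mul φ q₂ q₁ q h _ X := b.bc_mul φ (Pts.pull f q₂) (Pts.pull f q₁) (Pts.pull f q)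
    (by rw [← h, map_mul]) (by rw [← h, map_mul, map_mul]) X

/-! ### Equivariant objects -/

/-- An `F`-algebraic equivariant object: an object `obj` of `C` with isomorphisms
`α q : q · (obj ⊗ Λ) ≅ obj ⊗ Λ` for all `Λ` and all `q ∈ Q(Λ)`, satisfying the unit and cocycle
conditions and compatible with base change. -/
structure EquivObj (a : AlgAction F A C) where
  obj : C
  α : ∀ {Λ : Type u} [CommRing Λ] [Algebra F Λ] (q : Pts F A Λ), (a.act q).obj ⟨obj⟩ ≅ ⟨obj⟩
  α_one : ∀ {Λ : Type u} [CommRing Λ] [Algebra F Λ] (q : Pts F A Λ) (h : q = 1),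
    (α q).hom = (a.unit q h).hom.app ⟨obj⟩
  α_mul : ∀ {Λ : Type u} [CommRing Λ] [Algebra F Λ] (q₂ q₁ q : Pts F A Λ) (h : q₂ * q₁ = q),
    (a.mul q₂ q₁ q h).hom.app ⟨obj⟩ ≫ (α q).hom = (a.act q₂).map (α q₁).hom ≫ (α q₂).hom
  α_bc : ∀ {Λ Λ' : Type u} [CommRing Λ] [Algebra F Λ] [CommRing Λ'] [Algebra F Λ']
    (φ : Λ →ₐ[F] Λ') (q : Pts F A Λ),
    push φ (α q).hom = (a.bc φ q ⟨obj⟩).hom ≫ (α (Pts.push φ q)).hom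

namespace EquivObj

variable {a : AlgAction F A C}

/-- The morphisms `X.obj → Y.obj` of `C` that commute with the equivariant structures. -/
def homs (X Y : EquivObj a) : Submodule F (X.obj ⟶ Y.obj) where
  carrier := {f | ∀ (Λ : Type u) [CommRing Λ] [Algebra F Λ] (q : Pts F A Λ),
    (a.act q).map (tmul 1 f) ≫ (Y.α q).hom = (X.α q).hom ≫ tmul 1 f}
  zero_mem' := by
    intro Λ _ _ q
    rw [ScalarExt.tmul_zero, Functor.map_zero, Limits.zero_comp, Limits.comp_zero]
  add_mem' := by
    intro f g hf hg Λ _ _ q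
    rw [ScalarExt.tmul_add, Functor.map_add, Preadditive.add_comp, Preadditive.comp_add, hf Λ q,
      hg Λ q]
  smul_mem' := by
    intro r f hf Λ _ _ q
    rw [ScalarExt.tmul_smul, Functor.map_smul, Linear.smul_comp, Linear.comp_smul, hf Λ q]

/-- The category `C^Q` of `F`-algebraic equivariant objects. -/
instance category : Category (EquivObj a) where
  Hom X Y := homs X Y
  id X := ⟨𝟙 X.obj, by
    intro Λ _ _ q
    rw [tmul_id, CategoryTheory.Functor.map_id, Category.id_comp, Category.comp_id]⟩
  comp {X Y Z} f g := ⟨f.1 ≫ g.1, by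
    intro Λ _ _ q
    have hf := f.2 Λ q
    have hg := g.2 Λ q
    rw [one_tmul_comp, Functor.map_comp, Category.assoc, hg, reassoc_of% hf]⟩

instance preadditive : Preadditive (EquivObj a) where
  homGroup X Y := inferInstanceAs (AddCommGroup (homs X Y))
  add_comp _ _ _ _ _ _ := Subtype.ext (Preadditive.add_comp _ _ _ _ _ _)
  comp_add _ _ _ _ _ _ := Subtype.ext (Preadditive.comp_add _ _ _ _ _ _)

instance linear : Linear F (EquivObj a) where
  homModule X Y := inferInstanceAs (Module F (homs X Y))
  smul_comp _ _ _ _ _ _ := Subtype.ext (Linear.smul_comp _ _ _ _ _ _)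
  comp_smul _ _ _ _ _ _ := Subtype.ext (Linear.comp_smul _ _ _ _ _ _)

/-- The forgetful functor `C^Q → C`. -/
def forget (a : AlgAction F A C) : EquivObj a ⥤ C where
  obj X := X.obj
  map f := f.1

instance : (forget a).Additive where
instance : (forget a).Linear F where

/-- The inclusion `Hom_{C^Q}(X, Y) ⊗ Λ → Hom_C(X, Y) ⊗ Λ`, `r ⊗ f ↦ r ⊗ f`: the action on
morphisms of the functor `(C^Q)_Λ → C_Λ` induced by the forgetful functor. -/
def inclHom {Λ : Type u} [CommRing Λ] [Algebra F Λ] {X Y : ScalarExt F (EquivObj a) Λ} :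
    (X ⟶ Y) →ₗ[Λ] ((⟨X.of.obj⟩ : ScalarExt F C Λ) ⟶ ⟨Y.of.obj⟩) :=
  mapHom (forget a)

theorem act_inclHom {Λ Λ' : Type u} [CommRing Λ] [Algebra F Λ] [CommRing Λ'] [Algebra F Λ']
    (φ : Λ →ₐ[F] Λ') (q : Pts F A Λ') {X Y : ScalarExt F (EquivObj a) Λ} (f : X ⟶ Y) :
    (a.act q).map (push φ (inclHom f)) ≫ (Y.of.α q).hom =
      (X.of.α q).hom ≫ push φ (inclHom f) := by
  induction f using hom_induction with
  | h0 => rw [map_zero, map_zero, Functor.map_zero, Limits.zero_comp, Limits.comp_zero]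
  | ha f g hf hg =>
    rw [map_add, map_add, Functor.map_add, Preadditive.add_comp, Preadditive.comp_add, hf, hg]
  | ht r f =>
    have h := f.2 Λ' q
    change (a.act q).map (tmul (φ r) f.1) ≫ (Y.of.α q).hom = (X.of.α q).hom ≫ tmul (φ r) f.1
    rw [tmul_eq_smul, Functor.map_smul, Linear.smul_comp, Linear.comp_smul, h]

/-- The restriction functor `C^{Q₂} → C^{Q₁}` along the morphism `Q₁ → Q₂` with comorphism
`f : B → A`. -/
def res {B : Type u} [CommRing B] [HopfAlgebra F B] (b : AlgAction F B C) (f : B →ₐc[F] A) :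
    EquivObj b ⥤ EquivObj (b.res f) where
  obj X :=
    { obj := X.obj
      α := fun q => X.α (Pts.pull f q)
      α_one := fun q h => X.α_one _ (by rw [h, map_one])
      α_mul := fun q₂ q₁ q h => X.α_mul _ _ _ (by rw [← h, map_mul])
      α_bc := fun φ q => X.α_bc φ (Pts.pull f q) }
  map g := ⟨g.1, fun Λ _ _ q => g.2 Λ (Pts.pull f q)⟩

end EquivObj

/-! ### Equivariant objects over a base algebra, and the induced action -/

/-- The objects of the category `(C_Λ)^{Q_Λ}` of equivariant objects of `C_Λ` under the base change
`Q_Λ` of `Q` to `Λ`: an object `obj ⊗ Λ` of `C_Λ` with isomorphisms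
`α φ q : q · (obj ⊗ Λ') ≅ obj ⊗ Λ'` for all `φ : Λ → Λ'` and all `q ∈ Q(Λ')`. -/
structure EquivObjOver (a : AlgAction F A C) (Λ : Type u) [CommRing Λ] [Algebra F Λ] where
  obj : C
  α : ∀ {Λ' : Type u} [CommRing Λ'] [Algebra F Λ'] (_ : Λ →ₐ[F] Λ') (q : Pts F A Λ'),
    (a.act q).obj ⟨obj⟩ ≅ ⟨obj⟩
  α_one : ∀ {Λ' : Type u} [CommRing Λ'] [Algebra F Λ'] (φ : Λ →ₐ[F] Λ') (q : Pts F A Λ')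
    (h : q = 1), (α φ q).hom = (a.unit q h).hom.app ⟨obj⟩
  α_mul : ∀ {Λ' : Type u} [CommRing Λ'] [Algebra F Λ'] (φ : Λ →ₐ[F] Λ') (q₂ q₁ q : Pts F A Λ')
    (h : q₂ * q₁ = q),
    (a.mul q₂ q₁ q h).hom.app ⟨obj⟩ ≫ (α φ q).hom = (a.act q₂).map (α φ q₁).hom ≫ (α φ q₂).hom
  α_bc : ∀ {Λ' Λ'' : Type u} [CommRing Λ'] [Algebra F Λ'] [CommRing Λ''] [Algebra F Λ'']
    (φ : Λ →ₐ[F] Λ') (ψ : Λ' →ₐ[F] Λ'') (q : Pts F A Λ'),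
    push ψ (α φ q).hom = (a.bc ψ q ⟨obj⟩).hom ≫ (α (ψ.comp φ) (Pts.push ψ q)).hom

namespace EquivObjOver

variable {a : AlgAction F A C} {Λ : Type u} [CommRing Λ] [Algebra F Λ]

/-- A morphism of `C_Λ` commutes with the equivariant structures. -/
def IsEquivariant (X Y : EquivObjOver a Λ)
    (f : (⟨X.obj⟩ : ScalarExt F C Λ) ⟶ ⟨Y.obj⟩) : Prop :=
  ∀ (Λ' : Type u) [CommRing Λ'] [Algebra F Λ'] (φ : Λ →ₐ[F] Λ') (q : Pts F A Λ'),
    (a.act q).map (push φ f) ≫ (Y.α φ q).hom = (X.α φ q).hom ≫ push φ f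

/-- The category `(C_Λ)^{Q_Λ}`. -/
instance category : Category (EquivObjOver a Λ) where
  Hom X Y := {f : (⟨X.obj⟩ : ScalarExt F C Λ) ⟶ ⟨Y.obj⟩ // IsEquivariant X Y f}
  id X := ⟨𝟙 _, by
    intro Λ' _ _ φ q
    rw [push_id, CategoryTheory.Functor.map_id, Category.id_comp, Category.comp_id]⟩
  comp {X Y Z} f g := ⟨f.1 ≫ g.1, by
    intro Λ' _ _ φ q
    have hf := f.2 Λ' φ q
    have hg := g.2 Λ' φ q
    rw [push_comp, Functor.map_comp, Category.assoc, hg, reassoc_of% hf]⟩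

theorem comp_val {X Y Z : EquivObjOver a Λ} (f : X ⟶ Y) (g : Y ⟶ Z) :
    (f ≫ g).1 = f.1 ≫ g.1 := rfl

/-- An equivariant object of `C`, viewed as an equivariant object over `Λ`. -/
@[simps]
def ofEquivObj (Λ : Type u) [CommRing Λ] [Algebra F Λ] (X : EquivObj a) : EquivObjOver a Λ where
  obj := X.obj
  α _ q := X.α q
  α_one _ q h := X.α_one q h
  α_mul _ q₂ q₁ q h := X.α_mul q₂ q₁ q h
  α_bc _ ψ q := X.α_bc ψ q

/-- The canonical functor `(C^Q)_Λ → (C_Λ)^{Q_Λ}`. On morphisms it is the inclusion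
`Hom_{C^Q}(X, Y) ⊗ Λ → Hom_C(X, Y) ⊗ Λ`. -/
def incl (a : AlgAction F A C) (Λ : Type u) [CommRing Λ] [Algebra F Λ] :
    ScalarExt F (EquivObj a) Λ ⥤ EquivObjOver a Λ where
  obj X := ofEquivObj Λ X.of
  map f := ⟨EquivObj.inclHom f, fun _ _ _ φ q => EquivObj.act_inclHom φ q f⟩
  map_id X := Subtype.ext (mapHom_id (EquivObj.forget a) X)
  map_comp f g := Subtype.ext (mapHom_comp (EquivObj.forget a) f g)

end EquivObjOver

namespace AlgAction

section Swap

variable (a : AlgAction F A C) {Λ : Type u} [CommRing Λ] [Algebra F Λ]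

/-- The isomorphism `r · (q · X) ≅ (r q) · X = (q s) · X ≅ q · (s · X)` when `r q = q s`. -/
def swap (r q s : Pts F A Λ) (h : r * q = q * s) : a.act q ⋙ a.act r ≅ a.act s ⋙ a.act q :=
  a.mul r q (q * s) h ≪≫ (a.mul q s (q * s) rfl).symm

theorem swap_comp_mul (r q s t : Pts F A Λ) (h : r * q = q * s) (ht : q * s = t)
    (ht' : r * q = t) (X : ScalarExt F C Λ) :
    (a.swap r q s h).hom.app X ≫ (a.mul q s t ht).hom.app X = (a.mul r q t ht').hom.app X := by
  subst ht
  simp [swap]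

theorem swap_one (r q s : Pts F A Λ) (h : r * q = q * s) (hr : r = 1) (hs : s = 1)
    (X : ScalarExt F C Λ) :
    (a.swap r q s h).hom.app X ≫ (a.act q).map ((a.unit s hs).hom.app X) =
      (a.unit r hr).hom.app ((a.act q).obj X) := by
  have h1 : q * s = q := by rw [hs, mul_one]
  have h2 : r * q = q := by rw [hr, one_mul]
  rw [← a.mul_unit s q hs h1, ← a.unit_mul r q hr h2, a.swap_comp_mul]

theorem swap_mul (r₂ r₁ r q s₂ s₁ s : Pts F A Λ) (h₂ : r₂ * q = q * s₂) (h₁ : r₁ * q = q * s₁)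
    (h : r * q = q * s) (hr : r₂ * r₁ = r) (hs : s₂ * s₁ = s) (X : ScalarExt F C Λ) :
    (a.act r₂).map ((a.swap r₁ q s₁ h₁).hom.app X) ≫
        (a.swap r₂ q s₂ h₂).hom.app ((a.act s₁).obj X) ≫
          (a.act q).map ((a.mul s₂ s₁ s hs).hom.app X) =
      (a.mul r₂ r₁ r hr).hom.app ((a.act q).obj X) ≫ (a.swap r q s h).hom.app X := by
  have e1 : r₂ * (q * s₁) = q * s := by rw [← h₁, ← mul_assoc, hr, h]
  have e2 : (q * s₂) * s₁ = q * s := by rw [mul_assoc, hs]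
  rw [← cancel_mono ((a.mul q s (q * s) rfl).hom.app X)]
  simp only [Category.assoc]
  rw [a.assoc q s₂ s₁ (q * s₂) s (q * s) rfl hs rfl e2 X, a.swap_comp_mul r q s (q * s) h rfl h,
    ← Category.assoc ((a.swap r₂ q s₂ h₂).hom.app _),
    a.swap_comp_mul r₂ q s₂ (q * s₂) h₂ rfl h₂,
    ← a.assoc r₂ q s₁ (q * s₂) (q * s₁) (q * s) h₂ rfl e1 e2 X,
    ← Category.assoc, ← Functor.map_comp, a.swap_comp_mul r₁ q s₁ (q * s₁) h₁ rfl h₁,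
    a.assoc r₂ r₁ q r (q * s₁) (q * s) hr h₁ e1 h X]

theorem swap_bc {Λ' : Type u} [CommRing Λ'] [Algebra F Λ'] (φ : Λ →ₐ[F] Λ')
    (r q s : Pts F A Λ) (h : r * q = q * s)
    (h' : Pts.push φ r * Pts.push φ q = Pts.push φ q * Pts.push φ s) (X : ScalarExt F C Λ) :
    push φ ((a.swap r q s h).hom.app X) ≫ (a.bc φ q ((a.act s).obj X)).hom ≫
        (a.act (Pts.push φ q)).map (a.bc φ s X).hom =
      (a.bc φ r ((a.act q).obj X)).hom ≫ (a.act (Pts.push φ r)).map (a.bc φ q X).hom ≫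
        (a.swap (Pts.push φ r) (Pts.push φ q) (Pts.push φ s) h').hom.app ⟨X.of⟩ := by
  have e : Pts.push φ q * Pts.push φ s = Pts.push φ (q * s) := (map_mul _ _ _).symm
  have e' : Pts.push φ r * Pts.push φ q = Pts.push φ (q * s) := h'.trans e
  rw [← cancel_mono ((a.mul (Pts.push φ q) (Pts.push φ s) _ e).hom.app ⟨X.of⟩)]
  simp only [Category.assoc]
  rw [← a.bc_mul φ q s (q * s) rfl e X, a.swap_comp_mul _ _ _ _ h' e e',
    ← a.bc_mul φ r q (q * s) h e' X, ← Category.assoc, ← push_comp,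
    a.swap_comp_mul r q s (q * s) h rfl h]

/-- For `r q = q s`, the isomorphism `r · Y ≅ r · (q · X) ≅ q · (s · X) ≅ q · X ≅ Y` deduced from
`b : Y ≅ q · X` and `σ : s · X ≅ X`. -/
def conj (r q s : Pts F A Λ) (h : r * q = q * s) {X Y : ScalarExt F C Λ}
    (b : Y ≅ (a.act q).obj X) (σ : (a.act s).obj X ≅ X) : (a.act r).obj Y ≅ Y :=
  (a.act r).mapIso b ≪≫ (a.swap r q s h).app X ≪≫ (a.act q).mapIso σ ≪≫ b.symm

theorem conj_comp (r q s : Pts F A Λ) (h : r * q = q * s) {X Y : ScalarExt F C Λ}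
    (b : Y ≅ (a.act q).obj X) (σ : (a.act s).obj X ≅ X) :
    (a.conj r q s h b σ).hom ≫ b.hom =
      (a.act r).map b.hom ≫ (a.swap r q s h).hom.app X ≫ (a.act q).map σ.hom := by
  change ((a.act r).map b.hom ≫ (a.swap r q s h).hom.app X ≫ (a.act q).map σ.hom ≫ b.inv) ≫
    b.hom = _
  simp only [Category.assoc, Iso.inv_hom_id, Category.comp_id]

theorem conj_one (r q s : Pts F A Λ) (h : r * q = q * s) {X Y : ScalarExt F C Λ}
    (b : Y ≅ (a.act q).obj X) (σ : (a.act s).obj X ≅ X) (hr : r = 1) (hs : s = 1)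
    (hσ : σ.hom = (a.unit s hs).hom.app X) :
    (a.conj r q s h b σ).hom = (a.unit r hr).hom.app Y := by
  refine (cancel_mono b.hom).1 ?_
  rw [conj_comp, hσ, a.swap_one r q s h hr hs]
  exact (a.unit r hr).hom.naturality b.hom

theorem conj_mul (r₂ r₁ r q s₂ s₁ s : Pts F A Λ) (h₂ : r₂ * q = q * s₂) (h₁ : r₁ * q = q * s₁)
    (h : r * q = q * s) (hr : r₂ * r₁ = r) (hs : s₂ * s₁ = s) {X Y : ScalarExt F C Λ}
    (b : Y ≅ (a.act q).obj X) (σ₂ : (a.act s₂).obj X ≅ X) (σ₁ : (a.act s₁).obj X ≅ X)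
    (σ : (a.act s).obj X ≅ X)
    (hσ : (a.mul s₂ s₁ s hs).hom.app X ≫ σ.hom = (a.act s₂).map σ₁.hom ≫ σ₂.hom) :
    (a.mul r₂ r₁ r hr).hom.app Y ≫ (a.conj r q s h b σ).hom =
      (a.act r₂).map (a.conj r₁ q s₁ h₁ b σ₁).hom ≫ (a.conj r₂ q s₂ h₂ b σ₂).hom := by
  refine (cancel_mono b.hom).1 ?_
  have e := a.swap_mul r₂ r₁ r q s₂ s₁ s h₂ h₁ h hr hs X
  have n : (a.act r₂).map ((a.act r₁).map b.hom) ≫ (a.mul r₂ r₁ r hr).hom.app _ =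
    (a.mul r₂ r₁ r hr).hom.app _ ≫ (a.act r).map b.hom := (a.mul r₂ r₁ r hr).hom.naturality b.hom
  have n' : (a.act r₂).map ((a.act q).map σ₁.hom) ≫ (a.swap r₂ q s₂ h₂).hom.app X =
    (a.swap r₂ q s₂ h₂).hom.app _ ≫ (a.act q).map ((a.act s₂).map σ₁.hom) :=
      (a.swap r₂ q s₂ h₂).hom.naturality σ₁.hom
  rw [Category.assoc, Category.assoc, conj_comp, conj_comp, ← Category.assoc ((a.act r₂).map _),
    ← Functor.map_comp, conj_comp, ← reassoc_of% n, ← reassoc_of% e]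
  simp only [Functor.map_comp, Category.assoc]
  rw [reassoc_of% n', ← Functor.map_comp, ← Functor.map_comp, hσ]

theorem conj_natural (r q s : Pts F A Λ) (h : r * q = q * s) {X X' Y Y' : ScalarExt F C Λ}
    (b : Y ≅ (a.act q).obj X) (σ : (a.act s).obj X ≅ X)
    (b' : Y' ≅ (a.act q).obj X') (σ' : (a.act s).obj X' ≅ X') (f : X ⟶ X') (g : Y ⟶ Y')
    (hf : (a.act s).map f ≫ σ'.hom = σ.hom ≫ f) (hg : g ≫ b'.hom = b.hom ≫ (a.act q).map f) :
    (a.act r).map g ≫ (a.conj r q s h b' σ').hom = (a.conj r q s h b σ).hom ≫ g := by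
  refine (cancel_mono b'.hom).1 ?_
  have n : (a.act r).map ((a.act q).map f) ≫ (a.swap r q s h).hom.app X' =
    (a.swap r q s h).hom.app _ ≫ (a.act q).map ((a.act s).map f) :=
      (a.swap r q s h).hom.naturality f
  rw [Category.assoc, Category.assoc, conj_comp, hg, ← Category.assoc, ← Functor.map_comp, hg,
    Functor.map_comp, Category.assoc, reassoc_of% n, ← Functor.map_comp, hf, Functor.map_comp,
    reassoc_of% (a.conj_comp r q s h b σ)]

theorem conj_bc {Λ' : Type u} [CommRing Λ'] [Algebra F Λ'] (φ : Λ →ₐ[F] Λ')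
    (r q s : Pts F A Λ) (h : r * q = q * s)
    (h' : Pts.push φ r * Pts.push φ q = Pts.push φ q * Pts.push φ s) {X Y : ScalarExt F C Λ}
    (b : Y ≅ (a.act q).obj X) (σ : (a.act s).obj X ≅ X)
    (b' : (⟨Y.of⟩ : ScalarExt F C Λ') ≅ (a.act (Pts.push φ q)).obj ⟨X.of⟩)
    (σ' : (a.act (Pts.push φ s)).obj (⟨X.of⟩ : ScalarExt F C Λ') ≅ ⟨X.of⟩)
    (hb : b'.hom = push φ b.hom ≫ (a.bc φ q X).hom)
    (hσ : push φ σ.hom = (a.bc φ s X).hom ≫ σ'.hom) :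
    push φ (a.conj r q s h b σ).hom =
      (a.bc φ r Y).hom ≫
        (a.conj (Pts.push φ r) (Pts.push φ q) (Pts.push φ s) h' b' σ').hom := by
  refine (cancel_mono b'.hom).1 ?_
  have n := a.bc_natural φ q σ.hom
  have n' := a.bc_natural φ r b.hom
  have e := a.swap_bc φ r q s h h' X
  rw [Category.assoc, conj_comp, hb, ← Category.assoc, ← push_comp, conj_comp, push_comp,
    push_comp, Category.assoc, Category.assoc, n, hσ, Functor.map_comp, Functor.map_comp,
    reassoc_of% e, Category.assoc, ← reassoc_of% n']

end Swap

end AlgAction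

section Induced

variable {A' A'' : Type u} [CommRing A'] [HopfAlgebra F A'] [CommRing A''] [HopfAlgebra F A'']
  {i : A →ₐc[F] A'} {p : A'' →ₐc[F] A} (hex : IsShortExact i p) (a : AlgAction F A C)
  {Λ : Type u} [CommRing Λ] [Algebra F Λ]

theorem IsShortExact.exists_conj (hex : IsShortExact i p) (q : Pts F A Λ) (r : Pts F A' Λ) :
    ∃ s : Pts F A' Λ, Pts.pull i r * q = q * Pts.pull i s := by
  have h : Pts.pull p (q⁻¹ * Pts.pull i r * q) = 1 := by
    rw [map_mul, map_mul, (hex.exact Λ _).1 ⟨r, rfl⟩, mul_one, ← map_mul, inv_mul_cancel, map_one]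
  obtain ⟨s, hs⟩ := (hex.exact Λ _).2 h
  exact ⟨s, by rw [hs, mul_assoc, mul_inv_cancel_left]⟩

/-- The element `q⁻¹ r q` of the normal subgroup `Q'(Λ)` of `Q(Λ)`. -/
def IsShortExact.conj (q : Pts F A Λ) (r : Pts F A' Λ) : Pts F A' Λ :=
  (hex.exists_conj q r).choose

theorem IsShortExact.conj_spec (q : Pts F A Λ) (r : Pts F A' Λ) :
    Pts.pull i r * q = q * Pts.pull i (hex.conj q r) :=
  (hex.exists_conj q r).choose_spec

theorem IsShortExact.conj_eq (hex : IsShortExact i p) (q : Pts F A Λ) (r s : Pts F A' Λ)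
    (h : Pts.pull i r * q = q * Pts.pull i s) : hex.conj q r = s :=
  hex.injective Λ (mul_left_cancel ((hex.conj_spec q r).symm.trans h))

theorem IsShortExact.conj_one (q : Pts F A Λ) : hex.conj q 1 = 1 :=
  hex.conj_eq q 1 1 (by rw [map_one, one_mul, mul_one])

theorem IsShortExact.conj_mul (q : Pts F A Λ) (r₂ r₁ : Pts F A' Λ) :
    hex.conj q (r₂ * r₁) = hex.conj q r₂ * hex.conj q r₁ :=
  hex.conj_eq q _ _ (by
    rw [map_mul, map_mul, mul_assoc, hex.conj_spec q r₁, ← mul_assoc, hex.conj_spec q r₂,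
      mul_assoc])

theorem IsShortExact.conj_push {Λ' : Type u} [CommRing Λ'] [Algebra F Λ'] (φ : Λ →ₐ[F] Λ')
    (q : Pts F A Λ) (r : Pts F A' Λ) :
    hex.conj (Pts.push φ q) (Pts.push φ r) = Pts.push φ (hex.conj q r) :=
  hex.conj_eq _ _ _ (by
    rw [← Pts.push_pull, ← Pts.push_pull, ← map_mul, ← map_mul, hex.conj_spec])

namespace EquivObjOver

theorem translate_bc_aux (X : EquivObjOver (a.res i) Λ) (q : Pts F A Λ)
    {Λ' Λ'' : Type u} [CommRing Λ'] [Algebra F Λ'] [CommRing Λ''] [Algebra F Λ'']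
    (φ : Λ →ₐ[F] Λ') (ψ : Λ' →ₐ[F] Λ'') (r s : Pts F A' Λ') (t : Pts F A' Λ'')
    (hs : Pts.pull i r * Pts.push φ q = Pts.push φ q * Pts.pull i s)
    (ht : Pts.pull i (Pts.push ψ r) * Pts.push (ψ.comp φ) q =
      Pts.push (ψ.comp φ) q * Pts.pull i t) (hst : t = Pts.push ψ s) :
    push ψ (a.conj (Pts.pull i r) (Pts.push φ q) (Pts.pull i s) hs (a.bc φ q ⟨X.obj⟩)
      (X.α φ s)).hom =
    (a.bc ψ (Pts.pull i r) ⟨((a.act q).obj ⟨X.obj⟩).of⟩).hom ≫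
      (a.conj (Pts.pull i (Pts.push ψ r)) (Pts.push (ψ.comp φ) q) (Pts.pull i t) ht
        (a.bc (ψ.comp φ) q ⟨X.obj⟩) (X.α (ψ.comp φ) t)).hom := by
  subst hst
  have h1 := a.bc_comp φ ψ q ⟨X.obj⟩
  have h2 := X.α_bc φ ψ s
  have ht' : Pts.push ψ (Pts.pull i r) * Pts.push ψ (Pts.push φ q) =
    Pts.push ψ (Pts.push φ q) * Pts.push ψ (Pts.pull i s) := ht
  exact a.conj_bc ψ (Pts.pull i r) (Pts.push φ q) (Pts.pull i s) hs ht' (a.bc φ q ⟨X.obj⟩)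
    (X.α φ s) (a.bc (ψ.comp φ) q ⟨X.obj⟩) (X.α (ψ.comp φ) (Pts.push ψ s)) h1 h2

/-- The functor `q · - : (C_Λ)^{Q'_Λ} → (C_Λ)^{Q'_Λ}` for `q ∈ Q(Λ)`, given by
`(X, α) ↦ (q · X, ^q α)`, where `(^q α)_r` is
`r · (q · X) ≅ q · (s · X) → q · X`, the last morphism being `q · α_s`, for `s = q⁻¹ r q`. -/
def translate (q : Pts F A Λ) : EquivObjOver (a.res i) Λ ⥤ EquivObjOver (a.res i) Λ where
  obj X :=
    { obj := ((a.act q).obj ⟨X.obj⟩).of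
      α := fun φ r => a.conj (Pts.pull i r) (Pts.push φ q) (Pts.pull i (hex.conj (Pts.push φ q) r))
        (hex.conj_spec _ r) (a.bc φ q ⟨X.obj⟩) (X.α φ _)
      α_one := fun φ r hr => a.conj_one _ _ _ _ _ _ (by rw [hr, map_one])
        (by rw [hr, hex.conj_one, map_one]) (X.α_one φ _ (by rw [hr, hex.conj_one]))
      α_mul := fun φ r₂ r₁ r hr => a.conj_mul _ _ _ _ _ _ _ _ _ _ (by rw [← hr, map_mul])
        (by rw [← hr, hex.conj_mul, map_mul]) _ _ _ _
        (X.α_mul φ _ _ _ (by rw [← hr, hex.conj_mul]))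
      α_bc := fun φ ψ r => translate_bc_aux a X q φ ψ r
        (hex.conj (Pts.push φ q) r) (hex.conj (Pts.push (ψ.comp φ) q) (Pts.push ψ r))
        (hex.conj_spec (Pts.push φ q) r) (hex.conj_spec (Pts.push (ψ.comp φ) q) (Pts.push ψ r))
        (hex.conj_push ψ (Pts.push φ q) r) }
  map {X Y} f := ⟨(a.act q).map f.1, fun Λ' _ _ φ r =>
    a.conj_natural _ _ _ _ _ _ _ _ (push φ f.1) _ (f.2 Λ' φ _) (a.bc_natural φ q f.1)⟩
  map_id X := Subtype.ext (CategoryTheory.Functor.map_id _ _)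
  map_comp f g := Subtype.ext (Functor.map_comp _ _ _)

end EquivObjOver

/-- An isomorphism between two `Q`-actions on `C^{Q'}`: the one induced by the action `a` of `Q` on
`C`, which maps `X` to `translate q X`, and an action `B` of `Q` on `C^{Q'}`. It consists of natural
isomorphisms `γ q : q ·_a X ≅ q ·_B X` for all `Λ`, all `q ∈ Q(Λ)` and all `X` in `(C^{Q'})_Λ`,
compatible with the unit and multiplication isomorphisms of both actions and with base change.

As `q ·_a X` need only be a `Q'_Λ`-equivariant object of `C_Λ`, these are isomorphisms in
`(C_Λ)^{Q'_Λ}`, in which `(C^{Q'})_Λ` embeds by `incl`. The equations are equations of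
morphisms of `C_Λ`. -/
structure InducedActionIso (B : AlgAction F A (EquivObj (a.res i))) where
  γ : ∀ {Λ : Type u} [CommRing Λ] [Algebra F Λ] (q : Pts F A Λ),
    EquivObjOver.incl (a.res i) Λ ⋙ EquivObjOver.translate hex a q ≅
      B.act q ⋙ EquivObjOver.incl (a.res i) Λ
  γ_unit : ∀ {Λ : Type u} [CommRing Λ] [Algebra F Λ] (q : Pts F A Λ) (h : q = 1)
    (X : ScalarExt F (EquivObj (a.res i)) Λ),
    ((γ q).hom.app X).1 ≫ EquivObj.inclHom ((B.unit q h).hom.app X) =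
      (a.unit q h).hom.app ⟨X.of.obj⟩
  γ_mul : ∀ {Λ : Type u} [CommRing Λ] [Algebra F Λ] (q₂ q₁ q : Pts F A Λ) (h : q₂ * q₁ = q)
    (X : ScalarExt F (EquivObj (a.res i)) Λ),
    (a.act q₂).map ((γ q₁).hom.app X).1 ≫ ((γ q₂).hom.app ((B.act q₁).obj X)).1 ≫
        EquivObj.inclHom ((B.mul q₂ q₁ q h).hom.app X) =
      (a.mul q₂ q₁ q h).hom.app ⟨X.of.obj⟩ ≫ ((γ q).hom.app X).1
  γ_bc : ∀ {Λ Λ' : Type u} [CommRing Λ] [Algebra F Λ] [CommRing Λ'] [Algebra F Λ']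
    (φ : Λ →ₐ[F] Λ') (q : Pts F A Λ) (X : ScalarExt F (EquivObj (a.res i)) Λ),
    push φ ((γ q).hom.app X).1 ≫ EquivObj.inclHom (B.bc φ q X).hom =
      (a.bc φ q ⟨X.of.obj⟩).hom ≫ ((γ (Pts.push φ q)).hom.app ⟨X.of⟩).1

/-- The restriction of `γ` to `Q'` is the canonical trivialization of the induced action of `Q'` on
`C^{Q'}`: for `r ∈ Q'(Λ)`, the composite `r ·_a X ≅ r ·_B X = 1 ·_b X ≅ X` is the isomorphism
`α_r : r · X ≅ X` that is part of the equivariant object `X`. Here `B` is deduced from an action `b`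
of `Q''`. -/
def InducedActionIso.ExtendsTrivialization {hex : IsShortExact i p} {a : AlgAction F A C}
    {b : AlgAction F A'' (EquivObj (a.res i))} (g : InducedActionIso hex a (b.res p)) : Prop :=
  ∀ (Λ : Type u) [CommRing Λ] [Algebra F Λ] (r : Pts F A' Λ)
    (h : Pts.pull p (Pts.pull i r) = 1) (X : ScalarExt F (EquivObj (a.res i)) Λ),
    ((g.γ (Pts.pull i r)).hom.app X).1 ≫ EquivObj.inclHom ((b.unit _ h).hom.app X) =
      (X.of.α r).hom

end Induced

end Action

end ProAlg
end

/-! Let `(C, α)` be `Q`-equivariant. For `r` in `Q'` write `r q = q s` with `s = q⁻¹ r q`; the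
cocycle condition for both factorizations shows that `α_q` is a morphism of `Q'`-equivariant objects
from `q · (C, α|Q')` to `(C, α|Q')`. So `γ_q⁻¹` followed by `α_q` is a `Q`-equivariant structure on
`(C, α|Q')` for the action deduced from `Q''`. Conversely `(Y, β)` yields `γ_q` followed by
`β_{π(q)}`. Two points need an argument.

Full faithfulness. The morphism `γ_q⁻¹ ≫ α_q` lives in `(C_Λ)^{Q'_Λ}` and must come from
`(C^{Q'})_Λ`. A morphism is equivariant as soon as it is so at the universal point of the group, so
Hom spaces of equivariant objects are kernels of `F`-linear maps (`exact_universalDefect`), and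
tensoring with `Λ` over a field preserves kernels. Hence `incl` is fully faithful.

Descent. The hypothesis on `γ` over `Q'` says that the kernel of `Q → Q''` acts on the new object
through the unit isomorphisms (`isTrivialOnKernel`), so the structure at `q` depends only on `π(q)`.
A point of `Q''` lifts to `Q` only after a faithfully flat extension (`exists_lift`), but morphisms
of `C_Λ` satisfy faithfully flat descent. This gives an isomorphism for each point of `Q''`
(`exists_isDescended`), and its identities may be checked after the extension.

Both constructions keep underlying objects and morphisms, and `mem_homs_iff_assembleα` matches the
two equivariance conditions on morphisms. Full faithfulness and essential surjectivity of the
functor follow. -/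

noncomputable section

namespace ProAlg

open ScalarExt

/-! ### Faithfully flat descent for points and for morphisms of `C_Λ` -/

section Descent

variable {F : Type u} [Field F] {Λ Λ' : Type u} [CommRing Λ] [Algebra F Λ] [CommRing Λ']
  [Algebra F Λ']

/-- Pushouts of `F`-algebras along a faithfully flat map. -/
theorem exists_pushout_faithfullyFlat (φ : Λ →ₐ[F] Λ') (hφ : (φ : Λ →+* Λ').FaithfullyFlat)
    {Λ₁ : Type u} [CommRing Λ₁] [Algebra F Λ₁] (ψ : Λ →ₐ[F] Λ₁) :
    ∃ (Λ₂ : Type u) (_ : CommRing Λ₂) (_ : Algebra F Λ₂) (k₁ : Λ₁ →ₐ[F] Λ₂) (k : Λ' →ₐ[F] Λ₂),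
      k₁.comp ψ = k.comp φ ∧ (k₁ : Λ₁ →+* Λ₂).FaithfullyFlat := by
  let : Algebra Λ Λ' := (φ : Λ →+* Λ').toAlgebra
  let : Algebra Λ Λ₁ := (ψ : Λ →+* Λ₁).toAlgebra
  have : IsScalarTower F Λ Λ' := IsScalarTower.of_algebraMap_eq fun r => (φ.commutes r).symm
  have : IsScalarTower F Λ Λ₁ := IsScalarTower.of_algebraMap_eq fun r => (ψ.commutes r).symm
  have : Module.FaithfullyFlat Λ Λ' := hφ
  refine ⟨Λ₁ ⊗[Λ] Λ', inferInstance, inferInstance, Algebra.TensorProduct.includeLeft,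
    (Algebra.TensorProduct.includeRight : Λ' →ₐ[Λ] Λ₁ ⊗[Λ] Λ').restrictScalars F, ?_, ?_⟩
  · ext x
    have h1 := (Algebra.TensorProduct.includeRight : Λ' →ₐ[Λ] Λ₁ ⊗[Λ] Λ').commutes x
    have h2 := (Algebra.TensorProduct.includeLeft : Λ₁ →ₐ[Λ] Λ₁ ⊗[Λ] Λ').commutes x
    exact h2.trans h1.symm
  · have : Module.FaithfullyFlat Λ₁ (Λ₁ ⊗[Λ] Λ') := inferInstance
    exact (RingHom.faithfullyFlat_algebraMap_iff (R := Λ₁) (S := Λ₁ ⊗[Λ] Λ')).2 this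

/-- Faithfully flat maps of `F`-algebras are effective monomorphisms, and remain so after tensoring
with a vector space. -/
theorem exists_descent_data (φ : Λ →ₐ[F] Λ') (hφ : (φ : Λ →+* Λ').FaithfullyFlat) :
    ∃ (Λ₂ : Type u) (_ : CommRing Λ₂) (_ : Algebra F Λ₂) (k₁ k₂ : Λ' →ₐ[F] Λ₂),
      k₁.comp φ = k₂.comp φ ∧ ∀ (V : Type v) [AddCommGroup V] [Module F V] (x : Λ' ⊗[F] V),
        k₁.toLinearMap.rTensor V x = k₂.toLinearMap.rTensor V x →
          ∃ y : Λ ⊗[F] V, φ.toLinearMap.rTensor V y = x := by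
  let : Algebra Λ Λ' := (φ : Λ →+* Λ').toAlgebra
  have : IsScalarTower F Λ Λ' := IsScalarTower.of_algebraMap_eq fun r => (φ.commutes r).symm
  have : Module.FaithfullyFlat Λ Λ' := hφ
  refine ⟨Λ' ⊗[Λ] Λ', inferInstance, inferInstance, Algebra.TensorProduct.includeLeft,
    (Algebra.TensorProduct.includeRight : Λ' →ₐ[Λ] Λ' ⊗[Λ] Λ').restrictScalars F, ?_, ?_⟩
  · ext x
    have h1 := (Algebra.TensorProduct.includeRight : Λ' →ₐ[Λ] Λ' ⊗[Λ] Λ').commutes x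
    have h2 := (Algebra.TensorProduct.includeLeft : Λ' →ₐ[Λ] Λ' ⊗[Λ] Λ').commutes x
    exact h2.trans h1.symm
  · intro V _ _ x hx
    -- The sequence `Λ → Λ' ⇉ Λ' ⊗[Λ] Λ'` is exact by faithful flatness, and stays exact after
    -- tensoring over the field `F` with `V`.
    have h : Function.Exact φ.toLinearMap
        ((Algebra.TensorProduct.includeLeft : Λ' →ₐ[F] Λ' ⊗[Λ] Λ').toLinearMap -
        ((Algebra.TensorProduct.includeRight : Λ' →ₐ[Λ] Λ' ⊗[Λ] Λ').restrictScalars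
          F).toLinearMap) :=
      Algebra.IsEffective.of_faithfullyFlat Λ Λ'
    refine (Module.Flat.rTensor_exact V h x).1 ?_
    rw [LinearMap.rTensor_sub, LinearMap.sub_apply, hx, sub_self]

/-- A point of `Q''` lifts to `Q` after a faithfully flat extension. -/
theorem IsShortExact.exists_lift {A' A A'' : Type u} [CommRing A'] [HopfAlgebra F A']
    [CommRing A] [HopfAlgebra F A] [CommRing A''] [HopfAlgebra F A'']
    {i : A →ₐc[F] A'} {p : A'' →ₐc[F] A} (hex : IsShortExact i p) (s : Pts F A'' Λ) :
    ∃ (Λ₁ : Type u) (_ : CommRing Λ₁) (_ : Algebra F Λ₁) (φ : Λ →ₐ[F] Λ₁) (q : Pts F A Λ₁),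
      Pts.pull p q = Pts.push φ s ∧ (φ : Λ →+* Λ₁).FaithfullyFlat := by
  -- The fibre of `Q → Q''` above `s`: the pushout of the comorphism `p` along `s : A'' → Λ`. Its
  -- leg from `A` is the lift.
  obtain ⟨Λ₁, _, _, φ, k, h, hφ⟩ :=
    exists_pushout_faithfullyFlat (p : A'' →ₐ[F] A) hex.faithfullyFlat s.ofConv
  exact ⟨Λ₁, inferInstance, inferInstance, φ, WithConv.toConv k, WithConv.ext h.symm, hφ⟩

theorem Pts.push_comp {A : Type u} [CommRing A] [HopfAlgebra F A] {Λ₁ : Type u} [CommRing Λ₁]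
    [Algebra F Λ₁] (ψ : Λ' →ₐ[F] Λ₁) (φ : Λ →ₐ[F] Λ') (q : Pts F A Λ) :
    Pts.push (ψ.comp φ) q = Pts.push ψ (Pts.push φ q) := rfl

variable {C : Type w} [Category.{v} C] [Preadditive C] [Linear F C]

/-- Hom spaces are flat over the field `F`. This is what allows identities in `C_Λ` to be checked
after a faithfully flat extension. -/
theorem ScalarExt.push_injective (φ : Λ →ₐ[F] Λ') (hφ : Function.Injective φ)
    {X Y : ScalarExt F C Λ} :
    Function.Injective (push φ : (X ⟶ Y) → ((⟨X.of⟩ : ScalarExt F C Λ') ⟶ ⟨Y.of⟩)) :=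
  Module.Flat.rTensor_preserves_injective_linearMap (M := (X.of ⟶ Y.of)) φ.toLinearMap hφ

/-- The descent of isomorphisms along a faithfully flat map. -/
theorem ScalarExt.isIso_of_push (φ : Λ →ₐ[F] Λ') (hφ : (φ : Λ →+* Λ').FaithfullyFlat)
    {X Y : ScalarExt F C Λ} (f : X ⟶ Y) [IsIso (push φ f)] : IsIso f := by
  obtain ⟨Λ₂, _, _, k₁, k₂, hk, h⟩ := exists_descent_data.{v} φ hφ
  -- Both sides are inverse to the same morphism, since `k₁` and `k₂` agree on `Λ`; by uniqueness of
  -- inverses the inverse over `Λ'` satisfies the gluing condition.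
  have e : push k₁ (inv (push φ f)) = push k₂ (inv (push φ f)) := by
    have h1 : push k₁ (push φ f) ≫ push k₁ (inv (push φ f)) = 𝟙 _ := by
      rw [← push_comp, IsIso.hom_inv_id, push_id]
    have h2 : push k₂ (inv (push φ f)) ≫ push k₂ (push φ f) = 𝟙 _ := by
      rw [← push_comp, IsIso.inv_hom_id, push_id]
    have h3 : push k₂ (push φ f) = push k₁ (push φ f) := by
      rw [← push_algHom_comp, ← push_algHom_comp, hk]
    rw [h3] at h2
    rw [← Category.id_comp (push k₁ _), ← h2, Category.assoc, h1, Category.comp_id]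
  obtain ⟨g, hg⟩ := h (Y.of ⟶ X.of) (inv (push φ f)) e
  have hg' : push φ (X := Y) (Y := X) g = inv (push φ f) := hg
  refine ⟨g, push_injective φ hφ.injective ?_, push_injective φ hφ.injective ?_⟩
  · rw [push_comp, hg', IsIso.hom_inv_id, push_id]
  · refine (push_comp φ (X := Y) g f).trans ?_
    rw [hg', IsIso.inv_hom_id, push_id]

end Descent

/-! ### Descent of equivariant structures from `Q` to `Q''` -/

section DescentEquiv

variable {F : Type u} [Field F] {A' A A'' : Type u} [CommRing A'] [HopfAlgebra F A'] [CommRing A]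
  [HopfAlgebra F A] [CommRing A''] [HopfAlgebra F A''] {i : A →ₐc[F] A'} {p : A'' →ₐc[F] A}
  {D : Type w} [Category.{v} D] [Preadditive D] [Linear F D] {b : AlgAction F A'' D}

namespace EquivObj

/-- The isomorphism `Z.α q`, for `q` above a given point `s` of `Q''`. -/
def αOf (Z : EquivObj (b.res p)) {Λ : Type u} [CommRing Λ] [Algebra F Λ] (q : Pts F A Λ)
    (s : Pts F A'' Λ) (h : Pts.pull p q = s) :
    (b.act s).obj (⟨Z.obj⟩ : ScalarExt F D Λ) ≅ ⟨Z.obj⟩ :=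
  eqToIso (by subst h; rfl) ≪≫ Z.α q

theorem αOf_rfl (Z : EquivObj (b.res p)) {Λ : Type u} [CommRing Λ] [Algebra F Λ] (q : Pts F A Λ) :
    Z.αOf q _ rfl = Z.α q := by
  ext
  simp [αOf]

theorem αOf_mul (Z : EquivObj (b.res p)) {Λ : Type u} [CommRing Λ] [Algebra F Λ]
    (q₂ q₁ q : Pts F A Λ) (s₂ s₁ s : Pts F A'' Λ) (h₂ : Pts.pull p q₂ = s₂)
    (h₁ : Pts.pull p q₁ = s₁) (h : Pts.pull p q = s) (hq : q₂ * q₁ = q) (hs : s₂ * s₁ = s) :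
    (b.mul s₂ s₁ s hs).hom.app ⟨Z.obj⟩ ≫ (Z.αOf q s h).hom =
      (b.act s₂).map (Z.αOf q₁ s₁ h₁).hom ≫ (Z.αOf q₂ s₂ h₂).hom := by
  subst h₂ h₁ h
  simp only [αOf_rfl]
  exact Z.α_mul q₂ q₁ q hq

theorem αOf_bc (Z : EquivObj (b.res p)) {Λ Λ' : Type u} [CommRing Λ] [Algebra F Λ]
    [CommRing Λ'] [Algebra F Λ'] (φ : Λ →ₐ[F] Λ') (q : Pts F A Λ) (s : Pts F A'' Λ)
    (h : Pts.pull p q = s) (h' : Pts.pull p (Pts.push φ q) = Pts.push φ s) :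
    push φ (Z.αOf q s h).hom =
      (b.bc φ s ⟨Z.obj⟩).hom ≫ (Z.αOf (Pts.push φ q) (Pts.push φ s) h').hom := by
  subst h
  rw [αOf_rfl, Z.α_bc]
  exact congrArg (fun t => (b.bc φ (Pts.pull p q) ⟨Z.obj⟩).hom ≫ t.hom)
    (Z.αOf_rfl (Pts.push φ q)).symm

/-- The kernel of `Q → Q''` acts on `Z` through the unit isomorphisms. -/
def IsTrivialOnKernel (Z : EquivObj (b.res p)) : Prop :=
  ∀ (Λ : Type u) [CommRing Λ] [Algebra F Λ] (r : Pts F A Λ) (h : Pts.pull p r = 1),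
    (Z.α r).hom = (b.unit (Pts.pull p r) h).hom.app ⟨Z.obj⟩

/-- Write `q' = q (q⁻¹ q')` with `q⁻¹ q'` in the kernel. In the cocycle condition the second factor
contributes the unit isomorphism on one side and, by `mul_unit`, on the other side as well; it
cancels. -/
theorem IsTrivialOnKernel.αOf_eq {Z : EquivObj (b.res p)} (hZ : Z.IsTrivialOnKernel)
    {Λ : Type u} [CommRing Λ] [Algebra F Λ] (q q' : Pts F A Λ)
    (s : Pts F A'' Λ) (h : Pts.pull p q = s) (h' : Pts.pull p q' = s) :
    Z.αOf q s h = Z.αOf q' s h' := by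
  have hr : Pts.pull p (q⁻¹ * q') = 1 := by
    rw [map_mul, map_inv, h, h', inv_mul_cancel]
  have hs : s * Pts.pull p (q⁻¹ * q') = s := by rw [hr, mul_one]
  have e := Z.αOf_mul q (q⁻¹ * q') q' s _ s h rfl h' (mul_inv_cancel_left q q') hs
  rw [αOf_rfl, hZ Λ _ hr, b.mul_unit _ _ hr] at e
  ext
  exact ((cancel_epi _).1 e).symm

/-- `f : s · Z → Z` is the structure morphism at `s` obtained by descent. -/
def IsDescended (Z : EquivObj (b.res p)) {Λ : Type u} [CommRing Λ] [Algebra F Λ]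
    (s : Pts F A'' Λ) (f : (b.act s).obj (⟨Z.obj⟩ : ScalarExt F D Λ) ⟶ ⟨Z.obj⟩) : Prop :=
  ∀ {Λ' : Type u} [CommRing Λ'] [Algebra F Λ'] (φ : Λ →ₐ[F] Λ') (q : Pts F A Λ')
    (h : Pts.pull p q = Pts.push φ s),
    push φ f = (b.bc φ s ⟨Z.obj⟩).hom ≫ (Z.αOf q (Pts.push φ s) h).hom

/-- Over `Λ₃` the two lifts lie above the same point of `Q''`, so `αOf_eq` applies. Two different
covers are allowed because the lemma serves both for the gluing condition on one cover and for
comparing the descended morphism with an arbitrary lift. -/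
theorem IsTrivialOnKernel.push_bc_αOf {Z : EquivObj (b.res p)} (hZ : Z.IsTrivialOnKernel)
    {Λ Λ₁ Λ₂ Λ₃ : Type u} [CommRing Λ] [Algebra F Λ] [CommRing Λ₁] [Algebra F Λ₁]
    [CommRing Λ₂] [Algebra F Λ₂] [CommRing Λ₃] [Algebra F Λ₃] (s : Pts F A'' Λ)
    (φ₁ : Λ →ₐ[F] Λ₁) (φ₂ : Λ →ₐ[F] Λ₂) (ψ₁ : Λ₁ →ₐ[F] Λ₃) (ψ₂ : Λ₂ →ₐ[F] Λ₃)
    (e : ψ₁.comp φ₁ = ψ₂.comp φ₂)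
    (q₁ : Pts F A Λ₁) (h₁ : Pts.pull p q₁ = Pts.push φ₁ s)
    (q₂ : Pts F A Λ₂) (h₂ : Pts.pull p q₂ = Pts.push φ₂ s) :
    push ψ₁ ((b.bc φ₁ s ⟨Z.obj⟩).hom ≫ (Z.αOf q₁ (Pts.push φ₁ s) h₁).hom) =
      push ψ₂ ((b.bc φ₂ s ⟨Z.obj⟩).hom ≫ (Z.αOf q₂ (Pts.push φ₂ s) h₂).hom) := by
  have h₁' : Pts.pull p (Pts.push ψ₁ q₁) = Pts.push (ψ₁.comp φ₁) s := by
    rw [← Pts.push_pull, h₁, Pts.push_comp]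
  have h₂' : Pts.pull p (Pts.push ψ₂ q₂) = Pts.push (ψ₂.comp φ₂) s := by
    rw [← Pts.push_pull, h₂, Pts.push_comp]
  have k₁ := Z.αOf_bc ψ₁ q₁ _ h₁ h₁'
  have k₂ := Z.αOf_bc ψ₂ q₂ _ h₂ h₂'
  have l₁ := b.bc_comp φ₁ ψ₁ s ⟨Z.obj⟩
  have l₂ := b.bc_comp φ₂ ψ₂ s ⟨Z.obj⟩
  rw [push_comp, push_comp, k₁, k₂, ← Category.assoc, ← Category.assoc]
  refine (congrArg (· ≫ _) l₁.symm).trans (Eq.trans ?_ (congrArg (· ≫ _) l₂))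
  change (b.bc (ψ₁.comp φ₁) s ⟨Z.obj⟩).hom ≫
    (Z.αOf (Pts.push ψ₁ q₁) (Pts.push (ψ₁.comp φ₁) s) h₁').hom =
    (b.bc (ψ₂.comp φ₂) s ⟨Z.obj⟩).hom ≫
    (Z.αOf (Pts.push ψ₂ q₂) (Pts.push (ψ₂.comp φ₂) s) h₂').hom
  clear k₁ k₂ l₁ l₂
  generalize ψ₁.comp φ₁ = ψ at e h₁'
  subst e
  rw [hZ.αOf_eq _ _ _ h₁' h₂']

/-- The structure isomorphism at one lift of `s` over a faithfully flat cover satisfies the gluing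
condition, hence descends, and its descent is invertible by `isIso_of_push`. -/
theorem IsTrivialOnKernel.exists_isDescended {Z : EquivObj (b.res p)} (hZ : Z.IsTrivialOnKernel)
    (hex : IsShortExact i p) {Λ : Type u} [CommRing Λ] [Algebra F Λ] (s : Pts F A'' Λ) :
    ∃ f : (b.act s).obj (⟨Z.obj⟩ : ScalarExt F D Λ) ≅ ⟨Z.obj⟩, Z.IsDescended s f.hom := by
  obtain ⟨Λ₀, _, _, φ, q, h, hφ⟩ := hex.exists_lift s
  obtain ⟨Λ₂, _, _, k₁, k₂, hk, hd⟩ := exists_descent_data.{v} φ hφ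
  obtain ⟨f, hf⟩ := hd (((b.act s).obj (⟨Z.obj⟩ : ScalarExt F D Λ)).of ⟶ Z.obj)
    ((b.bc φ s ⟨Z.obj⟩).hom ≫ (Z.αOf q (Pts.push φ s) h).hom)
    (hZ.push_bc_αOf s φ φ k₁ k₂ hk q h q h)
  let f' : (b.act s).obj (⟨Z.obj⟩ : ScalarExt F D Λ) ⟶ ⟨Z.obj⟩ := f
  have hf' : push φ f' = (b.bc φ s ⟨Z.obj⟩).hom ≫ (Z.αOf q (Pts.push φ s) h).hom := hf
  have : IsIso (push φ f') := by rw [hf']; infer_instance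
  have : IsIso f' := isIso_of_push φ hφ f'
  refine ⟨asIso f', fun {Λ₁} _ _ ψ q' h' => ?_⟩
  -- An arbitrary lift `q'` over `ψ` is compared with the chosen `q` over the pushout of `φ` and
  -- `ψ`, which is faithfully flat over the target of `ψ`.
  obtain ⟨Λ₃, _, _, l₁, l, hl, hl₁⟩ := exists_pushout_faithfullyFlat φ hφ ψ
  apply push_injective l₁ hl₁.injective
  rw [← push_algHom_comp]
  refine Eq.trans ?_ (hZ.push_bc_αOf s φ ψ l l₁ hl.symm q h q' h')
  rw [← hf']
  exact (congrArg (fun χ => push χ f') hl).trans (push_algHom_comp l φ f')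

variable {Z : EquivObj (b.res p)} (hZ : Z.IsTrivialOnKernel) (hex : IsShortExact i p)

/-- The structure morphisms of the descended object. -/
def descendIso {Λ : Type u} [CommRing Λ] [Algebra F Λ] (s : Pts F A'' Λ) :
    (b.act s).obj (⟨Z.obj⟩ : ScalarExt F D Λ) ≅ ⟨Z.obj⟩ :=
  (hZ.exists_isDescended hex s).choose

theorem isDescended_descendIso {Λ : Type u} [CommRing Λ] [Algebra F Λ] (s : Pts F A'' Λ) :
    Z.IsDescended s (descendIso hZ hex s).hom :=
  (hZ.exists_isDescended hex s).choose_spec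

/-- Here `q` is itself a lift, over the identity of `Λ`. The isomorphism `bc` along the identity is
not assumed trivial, but it occurs in both `h` and `h'`. -/
theorem descendIso_pull {Λ : Type u} [CommRing Λ] [Algebra F Λ] (q : Pts F A Λ) :
    (descendIso hZ hex (Pts.pull p q)).hom = (Z.α q).hom := by
  have h := isDescended_descendIso hZ hex (Pts.pull p q) (AlgHom.id F Λ) q rfl
  have h' := Z.αOf_bc (AlgHom.id F Λ) q (Pts.pull p q) rfl rfl
  rw [αOf_rfl] at h'
  exact (push_algHom_id _).symm.trans ((h.trans h'.symm).trans (push_algHom_id _))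

/-- A lift of `Pts.push φ s` over `ψ` is also a lift of `s` over `ψ.comp φ`; `bc_comp` compares the
two. -/
theorem push_descendIso {Λ Λ' : Type u} [CommRing Λ] [Algebra F Λ] [CommRing Λ'] [Algebra F Λ']
    (φ : Λ →ₐ[F] Λ') (s : Pts F A'' Λ) :
    push φ (descendIso hZ hex s).hom =
      (b.bc φ s ⟨Z.obj⟩).hom ≫ (descendIso hZ hex (Pts.push φ s)).hom := by
  obtain ⟨Λ₁, _, _, ψ, q, h, hψ⟩ := hex.exists_lift (Pts.push φ s)
  apply push_injective ψ hψ.injective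
  have h1 := isDescended_descendIso hZ hex s (ψ.comp φ) q h
  have h2 := isDescended_descendIso hZ hex (Pts.push φ s) ψ q h
  have h3 := b.bc_comp φ ψ s ⟨Z.obj⟩
  refine ((push_algHom_comp ψ φ _).symm.trans h1).trans ?_
  rw [push_comp, h2, h3]
  exact Category.assoc _ _ _

/-- An equivariant object on which the kernel of the faithfully flat `Q → Q''` acts trivially is an
equivariant object for `Q''`. -/
def descend : EquivObj b where
  obj := Z.obj
  α s := descendIso hZ hex s
  α_one {Λ} _ _ s hs := by
    have h1 : Pts.pull p (1 : Pts F A Λ) = 1 := map_one _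
    subst hs
    -- The unit of `Q''` is only propositionally the image of the unit of `Q`, so the point is kept
    -- variable.
    have e : ∀ (s : Pts F A'' Λ) (_ : Pts.pull p 1 = s) (h' : s = 1), (descendIso hZ hex s).hom =
        (b.unit s h').hom.app ⟨Z.obj⟩ := by
      intro s hs h'
      subst hs
      rw [descendIso_pull, hZ Λ 1 h']
    exact e 1 h1 rfl
  α_mul {Λ} _ _ s₂ s₁ s hs := by
    -- Two successive extensions lift `s₂` and then `s₁` over one algebra; the product of the lifts
    -- is a lift of `s`.
    obtain ⟨Λ₁, _, _, φ₁, q₂, h₂, hφ₁⟩ := hex.exists_lift s₂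
    obtain ⟨Λ₂, _, _, φ₂, q₁, h₁, hφ₂⟩ := hex.exists_lift (Pts.push φ₁ s₁)
    have hinj : Function.Injective (φ₂.comp φ₁) := hφ₂.injective.comp hφ₁.injective
    have h₁' : Pts.pull p q₁ = Pts.push (φ₂.comp φ₁) s₁ := h₁
    have h₂' : Pts.pull p (Pts.push φ₂ q₂) = Pts.push (φ₂.comp φ₁) s₂ := by
      rw [← Pts.push_pull, h₂, Pts.push_comp]
    generalize φ₂.comp φ₁ = φ at hinj h₁' h₂'
    generalize Pts.push φ₂ q₂ = q₂' at h₂'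
    have hs' : Pts.push φ s₂ * Pts.push φ s₁ = Pts.push φ s := by rw [← map_mul, hs]
    have hq : Pts.pull p (q₂' * q₁) = Pts.push φ s := by rw [map_mul, h₁', h₂', hs']
    apply push_injective φ hinj
    have e := isDescended_descendIso hZ hex s φ _ hq
    have e₁ := isDescended_descendIso hZ hex s₁ φ _ h₁'
    have e₂ := isDescended_descendIso hZ hex s₂ φ _ h₂'
    have m := Z.αOf_mul q₂' q₁ _ _ _ _ h₂' h₁' hq rfl hs'
    have n := b.bc_natural φ s₂ (descendIso hZ hex s₁).hom
    have l := b.bc_mul φ s₂ s₁ s hs hs' ⟨Z.obj⟩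
    rw [push_comp, push_comp, e, e₂, reassoc_of% l, m, reassoc_of% n, e₁]
    simp only [Functor.map_comp, Category.assoc]
  α_bc φ s := push_descendIso hZ hex φ s

theorem descend_α_pull {Λ : Type u} [CommRing Λ] [Algebra F Λ] (q : Pts F A Λ) :
    ((descend hZ hex).α (Pts.pull p q)).hom = (Z.α q).hom :=
  descendIso_pull hZ hex q

/-- For `Q → Q''` faithfully flat, `Q`-equivariant morphisms of `Q''`-equivariant objects are
`Q''`-equivariant. -/
theorem mem_homs_of_pull (hex : IsShortExact i p) (X Y : EquivObj b) (f : X.obj ⟶ Y.obj)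
    (hf : ∀ (Λ : Type u) [CommRing Λ] [Algebra F Λ] (q : Pts F A Λ),
      (b.act (Pts.pull p q)).map (tmul 1 f) ≫ (Y.α (Pts.pull p q)).hom =
        (X.α (Pts.pull p q)).hom ≫ tmul 1 f) : f ∈ homs X Y := by
  intro Λ _ _ s
  obtain ⟨Λ₁, _, _, φ, q, h, hφ⟩ := hex.exists_lift s
  apply push_injective φ hφ.injective
  have e := hf Λ₁ q
  rw [h] at e
  have n := b.bc_natural φ s (tmul 1 f : (⟨X.obj⟩ : ScalarExt F D Λ) ⟶ ⟨Y.obj⟩)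
  have t : push φ (tmul 1 f : (⟨X.obj⟩ : ScalarExt F D Λ) ⟶ ⟨Y.obj⟩) = tmul 1 f := by
    rw [push_tmul, map_one]
  rw [push_comp, push_comp, Y.α_bc, X.α_bc, reassoc_of% n, t, e, Category.assoc]

end EquivObj
end DescentEquiv

/-! ### Full faithfulness of `(C^Q)_Λ → (C_Λ)^{Q_Λ}` -/

section FullyFaithful

variable {F : Type u} [Field F] {A : Type u} [CommRing A] [HopfAlgebra F A]
  {C : Type w} [Category.{v} C] [Preadditive C] [Linear F C] {a : AlgAction F A C}

variable (F A) in
/-- The universal point of `Q = Spec A`. -/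
def Pts.universal : Pts F A A := WithConv.toConv (AlgHom.id F A)

namespace EquivObj

/-- The defect of equivariance of a morphism at a point. -/
def defect (X Y : EquivObj a) {Λ : Type u} [CommRing Λ] [Algebra F Λ] (q : Pts F A Λ) :
    ((⟨X.obj⟩ : ScalarExt F C Λ) ⟶ ⟨Y.obj⟩) →ₗ[Λ] ((a.act q).obj ⟨X.obj⟩ ⟶ ⟨Y.obj⟩) where
  toFun f := (a.act q).map f ≫ (Y.α q).hom - (X.α q).hom ≫ f
  map_add' f g := by
    rw [Functor.map_add, Preadditive.add_comp, Preadditive.comp_add]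
    abel
  map_smul' r f := by
    rw [Functor.map_smul, Linear.smul_comp, Linear.comp_smul, smul_sub]
    rfl

theorem defect_eq_zero_iff (X Y : EquivObj a) {Λ : Type u} [CommRing Λ] [Algebra F Λ]
    (q : Pts F A Λ) (f : (⟨X.obj⟩ : ScalarExt F C Λ) ⟶ ⟨Y.obj⟩) :
    defect X Y q f = 0 ↔ (a.act q).map f ≫ (Y.α q).hom = (X.α q).hom ≫ f :=
  sub_eq_zero

theorem push_defect (X Y : EquivObj a) {Λ Λ' : Type u} [CommRing Λ] [Algebra F Λ] [CommRing Λ']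
    [Algebra F Λ'] (φ : Λ →ₐ[F] Λ') (q : Pts F A Λ) (f : (⟨X.obj⟩ : ScalarExt F C Λ) ⟶ ⟨Y.obj⟩) :
    push φ (defect X Y q f) =
      (a.bc φ q ⟨X.obj⟩).hom ≫ defect X Y (Pts.push φ q) (push φ f) := by
  have n := a.bc_natural φ q f
  change push φ ((a.act q).map f ≫ (Y.α q).hom - (X.α q).hom ≫ f) = _ ≫ (_ - _)
  rw [map_sub, push_comp, push_comp, Y.α_bc, X.α_bc, Preadditive.comp_sub, reassoc_of% n,
    Category.assoc]

/-- The defect of equivariance at the universal point. -/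
def universalDefect (X Y : EquivObj a) : (X.obj ⟶ Y.obj) →ₗ[F]
    A ⊗[F] (((a.act (Pts.universal F A)).obj ⟨X.obj⟩).of ⟶ Y.obj) where
  toFun f := defect X Y (Pts.universal F A) (tmul 1 f)
  map_add' f g := by
    rw [ScalarExt.tmul_add]
    exact map_add _ _ _
  map_smul' r f := by
    rw [ScalarExt.tmul_smul]
    refine (map_smul _ _ _).trans ?_
    exact algebraMap_smul A r (M := A ⊗[F] (((a.act (Pts.universal F A)).obj ⟨X.obj⟩).of ⟶ Y.obj)) _

/-- Any point `q : A → Λ` is the image of the universal point under `q` itself, so by `push_defect`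
a vanishing universal defect forces the defect at `q` to vanish. -/
theorem exact_universalDefect (X Y : EquivObj a) :
    Function.Exact (homs X Y).subtype (universalDefect X Y) := by
  intro f
  constructor
  · intro hf
    refine ⟨⟨f, fun Λ _ _ q => ?_⟩, rfl⟩
    have h := push_defect X Y q.ofConv (Pts.universal F A) (tmul 1 f)
    have h0 : defect X Y (Pts.universal F A) (tmul 1 f) = 0 := hf
    rw [h0, map_zero, push_tmul, map_one] at h
    have h' : defect X Y q (tmul 1 f) = 0 :=
      (cancel_epi (a.bc q.ofConv (Pts.universal F A) ⟨X.obj⟩).hom).1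
        (h.symm.trans Limits.comp_zero.symm)
    exact (defect_eq_zero_iff X Y q _).1 h'
  · rintro ⟨f, rfl⟩
    exact (defect_eq_zero_iff X Y _ _).2 (f.2 A _)

theorem inclHom_injective {Λ : Type u} [CommRing Λ] [Algebra F Λ]
    {X Y : ScalarExt F (EquivObj a) Λ} :
    Function.Injective (inclHom : (X ⟶ Y) → ((⟨X.of.obj⟩ : ScalarExt F C Λ) ⟶ ⟨Y.of.obj⟩)) :=
  Module.Flat.lTensor_preserves_injective_linearMap (M := Λ) (homs X.of Y.of).subtype
    (homs X.of Y.of).injective_subtype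

theorem assoc_symm_tmul {Λ V : Type*} [CommRing Λ] [Algebra F Λ] [AddCommGroup V] [Module F V]
    (r : Λ) (t : A ⊗[F] V) :
    (TensorProduct.assoc F Λ A V).symm (r ⊗ₜ t) =
      (r ⊗ₜ[F] (1 : A)) •
        (Algebra.TensorProduct.includeRight : A →ₐ[F] Λ ⊗[F] A).toLinearMap.rTensor V t := by
  induction t using TensorProduct.induction_on with
  | zero => simp
  | add s t hs ht => rw [TensorProduct.tmul_add, map_add, hs, ht, map_add, smul_add]
  | tmul y z => simp [TensorProduct.smul_tmul']

/-- Up to a base change isomorphism, the universal defect tensored with `Λ` is the defect at the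
universal point of `Q_Λ`, with values in `Λ ⊗ A`. Both sides are additive, and on pure tensors the
scalar comes out by linearity. -/
theorem assoc_symm_lTensor_universalDefect {Λ : Type u} [CommRing Λ] [Algebra F Λ]
    (X Y : EquivObj a) (f : (⟨X.obj⟩ : ScalarExt F C Λ) ⟶ ⟨Y.obj⟩) :
    (TensorProduct.assoc F Λ A _).symm ((universalDefect X Y).lTensor Λ f) =
      (a.bc (Algebra.TensorProduct.includeRight : A →ₐ[F] Λ ⊗[F] A) (Pts.universal F A)
        ⟨X.obj⟩).hom ≫ defect X Y _
          (push (Algebra.TensorProduct.includeLeft : Λ →ₐ[F] Λ ⊗[F] A) f) := by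
  induction f using hom_induction with
  | h0 =>
    refine ((congrArg _ (map_zero _)).trans (map_zero _)).trans ?_
    rw [map_zero, map_zero, Limits.comp_zero]
  | ha f g hf hg =>
    refine ((congrArg _ (map_add _ _ _)).trans (map_add _ _ _)).trans ?_
    rw [hf, hg, map_add, map_add, Preadditive.comp_add]
  | ht r f =>
    refine (assoc_symm_tmul r _).trans ?_
    have h := push_defect X Y (Algebra.TensorProduct.includeRight : A →ₐ[F] Λ ⊗[F] A)
      (Pts.universal F A) (tmul 1 f)
    rw [push_tmul, map_one] at h
    rw [push_tmul, tmul_eq_smul, map_smul, Linear.comp_smul, ← h]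
    rfl

end EquivObj

namespace EquivObjOver

variable (a) (Λ : Type u) [CommRing Λ] [Algebra F Λ]

instance : (incl a Λ).Faithful where
  map_injective h := EquivObj.inclHom_injective (congrArg Subtype.val h)

/-- Equivariance at the universal point of `Q_Λ` puts the morphism in the kernel of `Λ ⊗
universalDefect`, which by flatness is `Λ` tensored with the equivariant morphisms. -/
instance : (incl a Λ).Full where
  map_surjective {X Y} f := by
    have h : (EquivObj.universalDefect X.of Y.of).lTensor Λ f.1 = 0 := by
      apply (TensorProduct.assoc F Λ A _).symm.injective
      rw [map_zero]
      refine (EquivObj.assoc_symm_lTensor_universalDefect X.of Y.of f.1).trans ?_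
      have h0 := (EquivObj.defect_eq_zero_iff X.of Y.of _ _).2
        (f.2 (Λ ⊗[F] A) Algebra.TensorProduct.includeLeft
          (Pts.push Algebra.TensorProduct.includeRight (Pts.universal F A)))
      exact (congrArg _ h0).trans Limits.comp_zero
    obtain ⟨g, hg⟩ := (Module.Flat.lTensor_exact Λ (EquivObj.exact_universalDefect X.of Y.of) _).1 h
    exact ⟨g, Subtype.ext hg⟩

end EquivObjOver

end FullyFaithful

/-! ### Passage between `Q`-equivariant objects of `C` and of `C^{Q'}` -/

section Main

variable {F : Type u} [Field F] {A' A A'' : Type u} [CommRing A'] [HopfAlgebra F A'] [CommRing A]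
  [HopfAlgebra F A] [CommRing A''] [HopfAlgebra F A''] {i : A →ₐc[F] A'} {p : A'' →ₐc[F] A}
  {hex : IsShortExact i p}
  {C : Type w} [Category.{v} C] [Preadditive C] [Linear F C] {a : AlgAction F A C}

namespace EquivObjOver

variable {Λ : Type u} [CommRing Λ] [Algebra F Λ]

/-- An isomorphism of `C_Λ` that is equivariant is an isomorphism of `(C_Λ)^{Q_Λ}`. -/
@[simps]
def mkIso {X Y : EquivObjOver a Λ} (f : (⟨X.obj⟩ : ScalarExt F C Λ) ≅ ⟨Y.obj⟩)
    (hf : IsEquivariant X Y f.hom) : X ≅ Y where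
  hom := ⟨f.hom, hf⟩
  inv := ⟨f.inv, fun Λ' _ _ φ q => by
    have h := hf Λ' φ q
    have : IsIso (push φ f.hom) := (pushIso φ f).isIso_hom
    have e : push φ f.hom ≫ push φ f.inv = 𝟙 _ := (pushIso φ f).hom_inv_id
    rw [← cancel_epi ((a.act q).map (push φ f.hom)), reassoc_of% h, e,
      ← Functor.map_comp_assoc, e, CategoryTheory.Functor.map_id, Category.id_comp,
      Category.comp_id]⟩
  hom_inv_id := Subtype.ext f.hom_inv_id
  inv_hom_id := Subtype.ext f.inv_hom_id

end EquivObjOver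

namespace EquivObj

open EquivObjOver

theorem inclHom_comp {Λ : Type u} [CommRing Λ] [Algebra F Λ] {X Y Z : ScalarExt F (EquivObj a) Λ}
    (f : X ⟶ Y) (g : Y ⟶ Z) : inclHom (f ≫ g) = inclHom f ≫ inclHom g :=
  mapHom_comp (forget a) f g

theorem push_inclHom {Λ Λ' : Type u} [CommRing Λ] [Algebra F Λ] [CommRing Λ'] [Algebra F Λ']
    (φ : Λ →ₐ[F] Λ') {X Y : ScalarExt F (EquivObj a) Λ} (f : X ⟶ Y) :
    push φ (inclHom f) = inclHom (push φ f) :=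
  push_mapHom (forget a) φ f

variable (hex) in
/-- The structure morphism `α_q` of a `Q`-equivariant object is `Q'`-equivariant. -/
theorem isEquivariant_α (X : EquivObj a) {Λ : Type u} [CommRing Λ] [Algebra F Λ] (q : Pts F A Λ) :
    IsEquivariant ((translate hex a q).obj (ofEquivObj Λ ((res a i).obj X)))
      (ofEquivObj Λ ((res a i).obj X)) (X.α q).hom := by
  intro Λ' _ _ φ r
  have h := hex.conj_spec (Pts.push φ q) r
  have e := X.α_bc φ q
  -- The cocycle condition for the two factorizations `r q = q s` of one point; `swap` is the
  -- comparison between them.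
  have m₁ := X.α_mul (Pts.pull i r) (Pts.push φ q) _ h
  have m₂ := X.α_mul (Pts.push φ q) (Pts.pull i (hex.conj (Pts.push φ q) r)) _ rfl
  have k := a.swap_comp_mul _ _ _ _ h rfl h ⟨X.obj⟩
  change (a.act (Pts.pull i r)).map (push φ (X.α q).hom) ≫ (X.α (Pts.pull i r)).hom =
    (a.conj (Pts.pull i r) (Pts.push φ q) (Pts.pull i (hex.conj (Pts.push φ q) r)) h
      (a.bc φ q ⟨X.obj⟩) (X.α (Pts.pull i (hex.conj (Pts.push φ q) r)))).hom ≫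
      push φ (X.α q).hom
  rw [e, Functor.map_comp, Category.assoc, ← m₁, ← k, Category.assoc, m₂]
  have c := a.conj_comp _ _ _ h (a.bc φ q ⟨X.obj⟩)
    (X.α (Pts.pull i (hex.conj (Pts.push φ q) r)))
  refine Eq.trans ?_ (Category.assoc _ _ _)
  refine Eq.trans ?_ (congrArg (· ≫ _) c.symm)
  simp only [Category.assoc]

/-- The structure isomorphism `α_q` as an isomorphism of `(C_Λ)^{Q'_Λ}`. -/
def αOver (hex : IsShortExact i p) (X : EquivObj a) {Λ : Type u} [CommRing Λ] [Algebra F Λ]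
    (q : Pts F A Λ) :
    (incl (a.res i) Λ ⋙ translate hex a q).obj ⟨(res a i).obj X⟩ ≅
      (incl (a.res i) Λ).obj ⟨(res a i).obj X⟩ :=
  mkIso (X.α q) (isEquivariant_α hex X q)

variable {B : AlgAction F A (EquivObj (a.res i))} (g : InducedActionIso hex a B)

/-- The structure isomorphisms `γ_q⁻¹ ≫ α_q` of the `Q`-equivariant object of `C^{Q'}` deduced from
a `Q`-equivariant object of `C`. -/
def liftα (X : EquivObj a) {Λ : Type u} [CommRing Λ] [Algebra F Λ] (q : Pts F A Λ) :
    (B.act q).obj (⟨(res a i).obj X⟩ : ScalarExt F _ Λ) ≅ ⟨(res a i).obj X⟩ :=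
  (incl (a.res i) Λ).preimageIso ((g.γ q).symm.app ⟨(res a i).obj X⟩ ≪≫ αOver hex X q)

/-- The isomorphism of `C_Λ` underlying `γ_q`. -/
def γIso {Λ : Type u} [CommRing Λ] [Algebra F Λ] (q : Pts F A Λ)
    (X : ScalarExt F (EquivObj (a.res i)) Λ) :
    (a.act q).obj ⟨X.of.obj⟩ ≅ ⟨((B.act q).obj X).of.obj⟩ where
  hom := ((g.γ q).hom.app X).1
  inv := ((g.γ q).inv.app X).1
  hom_inv_id := congrArg Subtype.val ((g.γ q).hom_inv_id_app X)
  inv_hom_id := congrArg Subtype.val ((g.γ q).inv_hom_id_app X)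

theorem γIso_liftα (X : EquivObj a) {Λ : Type u} [CommRing Λ] [Algebra F Λ] (q : Pts F A Λ) :
    (γIso g q ⟨(res a i).obj X⟩).hom ≫ inclHom (liftα g X q).hom = (X.α q).hom := by
  have h : (incl (a.res i) Λ).map (liftα g X q).hom =
      (g.γ q).inv.app ⟨(res a i).obj X⟩ ≫ (αOver hex X q).hom :=
    (incl (a.res i) Λ).map_preimage _
  have h' : (g.γ q).hom.app ⟨(res a i).obj X⟩ ≫ (incl (a.res i) Λ).map (liftα g X q).hom =
      (αOver hex X q).hom := by
    rw [h, Iso.hom_inv_id_app_assoc]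
  exact congrArg Subtype.val h'

theorem γIso_naturality {Λ : Type u} [CommRing Λ] [Algebra F Λ] (q : Pts F A Λ)
    {X Y : ScalarExt F (EquivObj (a.res i)) Λ} (f : X ⟶ Y) :
    (a.act q).map (inclHom f) ≫ (γIso g q Y).hom =
      (γIso g q X).hom ≫ inclHom ((B.act q).map f) :=
  congrArg Subtype.val ((g.γ q).hom.naturality f)

theorem γIso_unit {Λ : Type u} [CommRing Λ] [Algebra F Λ] (q : Pts F A Λ) (h : q = 1)
    (X : ScalarExt F (EquivObj (a.res i)) Λ) :
    (γIso g q X).hom ≫ inclHom ((B.unit q h).hom.app X) = (a.unit q h).hom.app ⟨X.of.obj⟩ :=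
  g.γ_unit q h X

/-- Together with `γIso_mul_comp_act`, transports the two sides of the cocycle condition between
`C^{Q'}` and `C`; `lift` and `assemble` use the pair in opposite directions. -/
theorem γIso_mul_comp {Λ : Type u} [CommRing Λ] [Algebra F Λ] (q₂ q₁ q : Pts F A Λ)
    (h : q₂ * q₁ = q) (X : ScalarExt F (EquivObj (a.res i)) Λ)
    {Y : ScalarExt F (EquivObj (a.res i)) Λ} (f : (B.act q).obj X ⟶ Y) :
    (a.act q₂).map (γIso g q₁ X).hom ≫ (γIso g q₂ ((B.act q₁).obj X)).hom ≫
        inclHom ((B.mul q₂ q₁ q h).hom.app X ≫ f) =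
      (a.mul q₂ q₁ q h).hom.app ⟨X.of.obj⟩ ≫ (γIso g q X).hom ≫ inclHom f := by
  have e : (a.act q₂).map (γIso g q₁ X).hom ≫ (γIso g q₂ ((B.act q₁).obj X)).hom ≫
      inclHom ((B.mul q₂ q₁ q h).hom.app X) =
    (a.mul q₂ q₁ q h).hom.app ⟨X.of.obj⟩ ≫ (γIso g q X).hom := g.γ_mul q₂ q₁ q h X
  have e' := congrArg (· ≫ inclHom f) e
  simp only [Category.assoc] at e'
  rw [← e', inclHom_comp]

theorem γIso_mul_comp_act {Λ : Type u} [CommRing Λ] [Algebra F Λ] (q₂ q₁ : Pts F A Λ)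
    (X : ScalarExt F (EquivObj (a.res i)) Λ) {Y Z : ScalarExt F (EquivObj (a.res i)) Λ}
    (f : (B.act q₁).obj X ⟶ Y) (f' : (B.act q₂).obj Y ⟶ Z) :
    (a.act q₂).map (γIso g q₁ X).hom ≫ (γIso g q₂ ((B.act q₁).obj X)).hom ≫
        inclHom ((B.act q₂).map f ≫ f') =
      (a.act q₂).map ((γIso g q₁ X).hom ≫ inclHom f) ≫ (γIso g q₂ Y).hom ≫ inclHom f' := by
  have n := γIso_naturality g q₂ f
  rw [inclHom_comp, ← reassoc_of% n, Functor.map_comp, Category.assoc]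

theorem γIso_bc_comp {Λ Λ' : Type u} [CommRing Λ] [Algebra F Λ] [CommRing Λ'] [Algebra F Λ']
    (φ : Λ →ₐ[F] Λ') (q : Pts F A Λ) (X : ScalarExt F (EquivObj (a.res i)) Λ)
    {Y : ScalarExt F (EquivObj (a.res i)) Λ'} (f : (B.act (Pts.push φ q)).obj ⟨X.of⟩ ⟶ Y) :
    push φ (γIso g q X).hom ≫ inclHom ((B.bc φ q X).hom ≫ f) =
      (a.bc φ q ⟨X.of.obj⟩).hom ≫ (γIso g (Pts.push φ q) ⟨X.of⟩).hom ≫ inclHom f := by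
  have e : push φ (γIso g q X).hom ≫ inclHom (B.bc φ q X).hom =
    (a.bc φ q ⟨X.of.obj⟩).hom ≫ (γIso g (Pts.push φ q) ⟨X.of⟩).hom := g.γ_bc φ q X
  rw [inclHom_comp, reassoc_of% e]

theorem eq_of_γIso_comp {Λ : Type u} [CommRing Λ] [Algebra F Λ] (q : Pts F A Λ)
    {X Y : ScalarExt F (EquivObj (a.res i)) Λ} {f f' : (B.act q).obj X ⟶ Y}
    (h : (γIso g q X).hom ≫ inclHom f = (γIso g q X).hom ≫ inclHom f') : f = f' :=
  inclHom_injective ((cancel_epi (γIso g q X).hom).1 h)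

/-- The `Q`-equivariant object of `C^{Q'}` deduced from a `Q`-equivariant object of `C`. -/
def lift (X : EquivObj a) : EquivObj B where
  obj := (res a i).obj X
  α q := liftα g X q
  α_one q h := eq_of_γIso_comp g q (by
    rw [γIso_liftα, X.α_one q h]
    exact (γIso_unit g q h ⟨(res a i).obj X⟩).symm)
  α_mul q₂ q₁ q h := by
    -- The source is `q₂ · (q₁ · X)` for the action `B`, so both `γ_{q₂}` and the image of `γ_{q₁}`
    -- under `q₂` are needed to reach it from `C_Λ`.
    refine eq_of_γIso_comp g q₂ (X := (B.act q₁).obj ⟨(res a i).obj X⟩)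
      ((cancel_epi ((a.act q₂).map (γIso g q₁ ⟨(res a i).obj X⟩).hom)).1 ?_)
    refine (γIso_mul_comp g q₂ q₁ q h _ _).trans
      (Eq.trans ?_ (γIso_mul_comp_act g q₂ q₁ _ _ _).symm)
    rw [γIso_liftα, γIso_liftα, γIso_liftα]
    exact X.α_mul q₂ q₁ q h
  α_bc φ q := by
    refine inclHom_injective
      ((Iso.cancel_iso_hom_left (pushIso φ (γIso g q ⟨(res a i).obj X⟩)) _ _).1 ?_)
    refine Eq.trans ?_ (γIso_bc_comp g φ q ⟨(res a i).obj X⟩ (liftα g X (Pts.push φ q)).hom).symm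
    rw [γIso_liftα, ← push_inclHom, pushIso_hom, ← push_comp, γIso_liftα]
    exact X.α_bc φ q

/-- The isomorphism of `C_Λ` underlying an isomorphism of `(C^Q)_Λ`. -/
def inclIso {Λ : Type u} [CommRing Λ] [Algebra F Λ] {X Y : ScalarExt F (EquivObj a) Λ}
    (f : X ≅ Y) : (⟨X.of.obj⟩ : ScalarExt F C Λ) ≅ ⟨Y.of.obj⟩ where
  hom := inclHom f.hom
  inv := inclHom f.inv
  hom_inv_id := by
    rw [← inclHom_comp, f.hom_inv_id]
    exact mapHom_id (forget a) X
  inv_hom_id := by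
    rw [← inclHom_comp, f.inv_hom_id]
    exact mapHom_id (forget a) Y

/-- The isomorphism `γ_q ≫ β_q` deduced from a `Q`-equivariant object of `C^{Q'}`. -/
def assembleα (W : EquivObj B) {Λ : Type u} [CommRing Λ] [Algebra F Λ] (q : Pts F A Λ) :
    (a.act q).obj (⟨W.obj.obj⟩ : ScalarExt F C Λ) ≅ ⟨W.obj.obj⟩ :=
  γIso g q ⟨W.obj⟩ ≪≫ inclIso (W.α q)

theorem assembleα_hom (W : EquivObj B) {Λ : Type u} [CommRing Λ] [Algebra F Λ] (q : Pts F A Λ) :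
    (assembleα g W q).hom = (γIso g q ⟨W.obj⟩).hom ≫ inclHom (W.α q).hom := rfl

/-- The `Q`-equivariant object of `C` deduced from a `Q`-equivariant object of `C^{Q'}`. -/
def assemble (W : EquivObj B) : EquivObj a where
  obj := W.obj.obj
  α q := assembleα g W q
  α_one q h := by
    rw [assembleα_hom, W.α_one q h]
    exact γIso_unit g q h ⟨W.obj⟩
  α_mul q₂ q₁ q h := by
    have m := congrArg (fun t => (a.act q₂).map (γIso g q₁ ⟨W.obj⟩).hom ≫
      (γIso g q₂ ((B.act q₁).obj ⟨W.obj⟩)).hom ≫ inclHom t) (W.α_mul q₂ q₁ q h)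
    have m₁ := γIso_mul_comp g q₂ q₁ q h ⟨W.obj⟩ (W.α q).hom
    have m₂ := γIso_mul_comp_act g q₂ q₁ ⟨W.obj⟩ (W.α q₁).hom (W.α q₂).hom
    rw [assembleα_hom, assembleα_hom, assembleα_hom]
    exact m₁.symm.trans (m.trans m₂)
  α_bc φ q := by
    have m := γIso_bc_comp g φ q ⟨W.obj⟩ (W.α (Pts.push φ q)).hom
    have n := push_inclHom φ (W.α q).hom
    rw [W.α_bc] at n
    rw [assembleα_hom, assembleα_hom, push_comp]
    exact (congrArg (push φ (γIso g q ⟨W.obj⟩).hom ≫ ·) n).trans m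

end EquivObj

/-! ### The equivalence `C^Q ≌ (C^{Q'})^{Q''}` -/

open EquivObj

variable {b : AlgAction F A'' (EquivObj (a.res i))} {g : InducedActionIso hex a (b.res p)}

/-- By exactness a point of the kernel comes from `Q'`. There `γ_r` followed by the unit isomorphism
is `α_r`, as is `γ_r` followed by the structure of `lift`; cancel `γ_r`. -/
theorem InducedActionIso.ExtendsTrivialization.isTrivialOnKernel (hg : g.ExtendsTrivialization)
    (X : EquivObj a) : (lift g X).IsTrivialOnKernel := by
  intro Λ _ _ r h
  obtain ⟨r, rfl⟩ := (hex.exact Λ r).2 h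
  refine eq_of_γIso_comp g _ ?_
  exact (γIso_liftα g X _).trans (hg Λ r h ⟨(res a i).obj X⟩).symm

namespace EquivObj

/-- An isomorphism between the underlying objects that is equivariant is an isomorphism of
equivariant objects. -/
def mkIso {X Y : EquivObj a} (f : X.obj ≅ Y.obj) (hf : f.hom ∈ homs X Y) : X ≅ Y where
  hom := ⟨f.hom, hf⟩
  inv := ⟨f.inv, fun Λ _ _ q => by
    have h := hf Λ q
    have e : (tmul 1 f.hom : (⟨X.obj⟩ : ScalarExt F C Λ) ⟶ ⟨Y.obj⟩) ≫ tmul 1 f.inv = 𝟙 _ := by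
      rw [← one_tmul_comp, f.hom_inv_id, tmul_id]
    have e' : (tmul 1 f.inv : (⟨Y.obj⟩ : ScalarExt F C Λ) ⟶ ⟨X.obj⟩) ≫ tmul 1 f.hom = 𝟙 _ := by
      rw [← one_tmul_comp, f.inv_hom_id, tmul_id]
    have : IsIso (tmul 1 f.hom : (⟨X.obj⟩ : ScalarExt F C Λ) ⟶ ⟨Y.obj⟩) := ⟨_, e, e'⟩
    rw [← cancel_epi ((a.act q).map (tmul 1 f.hom)), reassoc_of% h, e,
      ← Functor.map_comp_assoc, e, CategoryTheory.Functor.map_id, Category.id_comp,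
      Category.comp_id]⟩
  hom_inv_id := Subtype.ext f.hom_inv_id
  inv_hom_id := Subtype.ext f.inv_hom_id

/-- By naturality of `γ_q`, both sides of the equation in `C` are `γ_q` followed by the sides of the
equation in `C^{Q'}` at `π(q)`. Points of the form `π(q)` suffice by `mem_homs_of_pull`. -/
theorem mem_homs_iff_assembleα (g : InducedActionIso hex a (b.res p)) {X Y : EquivObj b}
    (f : X.obj ⟶ Y.obj) :
    f ∈ homs X Y ↔ ∀ (Λ : Type u) [CommRing Λ] [Algebra F Λ] (q : Pts F A Λ),
      (a.act q).map (tmul 1 f.1) ≫ (assembleα g ((res b p).obj Y) q).hom =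
        (assembleα g ((res b p).obj X) q).hom ≫ tmul 1 f.1 := by
  have key (Λ : Type u) [CommRing Λ] [Algebra F Λ] (q : Pts F A Λ) :
      (a.act q).map (tmul 1 f.1) ≫ (assembleα g ((res b p).obj Y) q).hom = (γIso g q ⟨X.obj⟩).hom ≫
        inclHom ((b.act (Pts.pull p q)).map (tmul 1 f) ≫ (Y.α (Pts.pull p q)).hom) := by
    have n := γIso_naturality g q (tmul 1 f : (⟨X.obj⟩ : ScalarExt F _ Λ) ⟶ ⟨Y.obj⟩)
    rw [assembleα_hom, inclHom_comp]
    exact (Category.assoc _ _ _).symm.trans ((congrArg (· ≫ _) n).trans (Category.assoc _ _ _))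
  have key' (Λ : Type u) [CommRing Λ] [Algebra F Λ] (q : Pts F A Λ) :
      (assembleα g ((res b p).obj X) q).hom ≫ tmul 1 f.1 = (γIso g q ⟨X.obj⟩).hom ≫
        inclHom ((X.α (Pts.pull p q)).hom ≫ tmul 1 f) := by
    rw [assembleα_hom, inclHom_comp]
    exact Category.assoc _ _ _
  constructor
  · intro h Λ _ _ q
    rw [key, key', h]
  · intro h
    exact mem_homs_of_pull hex X Y f fun Λ _ _ q => eq_of_γIso_comp g q
      ((key Λ q).symm.trans ((h Λ q).trans (key' Λ q)))

variable (hg : g.ExtendsTrivialization)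

/-- Since `r` maps to `1` in `Q''`, the structure of `W` there is the unit isomorphism, and `hg`
applies. Assembling thus does not change the `Q'`-structure. -/
theorem assemble_α_pull (hg : g.ExtendsTrivialization) (W : EquivObj b) {Λ : Type u} [CommRing Λ]
    [Algebra F Λ] (r : Pts F A' Λ) :
    ((assemble g ((res b p).obj W)).α (Pts.pull i r)).hom = (W.obj.α r).hom := by
  have h : Pts.pull p (Pts.pull i r) = 1 := (hex.exact Λ _).1 ⟨r, rfl⟩
  refine Eq.trans ?_ (hg Λ r h ⟨W.obj⟩)
  exact congrArg (fun t => (γIso g (Pts.pull i r) ⟨W.obj⟩).hom ≫ inclHom t) (W.α_one _ h)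

theorem assembleα_descend_lift (X : EquivObj a) {Λ : Type u} [CommRing Λ] [Algebra F Λ]
    (q : Pts F A Λ) :
    (assembleα g ((res b p).obj (descend (hg.isTrivialOnKernel X) hex)) q).hom = (X.α q).hom := by
  have h := descend_α_pull (hg.isTrivialOnKernel X) hex q
  exact (congrArg (fun t => (γIso g q ⟨(res a i).obj X⟩).hom ≫ inclHom t) h).trans
    (γIso_liftα g X q)

/-- The functor `C^Q ⥤ (C^{Q'})^{Q''}`. -/
def toIterated : EquivObj a ⥤ EquivObj b where
  obj X := descend (hg.isTrivialOnKernel X) hex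
  map {X Y} f := ⟨(res a i).map f, (mem_homs_iff_assembleα g _).2 fun Λ _ _ q => by
    rw [assembleα_descend_lift hg, assembleα_descend_lift hg]
    exact f.2 Λ q⟩
  map_id X := Subtype.ext ((res a i).map_id X)
  map_comp f g := Subtype.ext ((res a i).map_comp f g)

/-- Essential surjectivity of `toIterated`: an equivariant object of `C^{Q'}` is recovered from the
equivariant object of `C` assembled from it. -/
def toIteratedAssembleIso (W : EquivObj b) :
    (toIterated hg).obj (assemble g ((res b p).obj W)) ≅ W :=
  -- The identity of the underlying object: the inner `mkIso` checks `Q'`-equivariance, the outer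
  -- one `Q''`-equivariance.
  mkIso (mkIso (Iso.refl W.obj.obj) fun Λ _ _ r => by
      refine (congrArg (· ≫ _) ((a.act (Pts.pull i r)).map_id _)).trans ?_
      exact (Category.id_comp _).trans
        ((assemble_α_pull hg W r).symm.trans (Category.comp_id _).symm))
    ((mem_homs_iff_assembleα g _).2 fun Λ _ _ q => by
      refine (congrArg (· ≫ _) ((a.act q).map_id _)).trans ?_
      exact (Category.id_comp _).trans
        ((assembleα_descend_lift hg (assemble g ((res b p).obj W)) q).symm.trans
          (Category.comp_id _).symm))

theorem hom_ext {X Y : EquivObj a} {f f' : X ⟶ Y} (h : f.1 = f'.1) : f = f' := Subtype.ext h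

theorem add_val {X Y : EquivObj a} (f f' : X ⟶ Y) : (f + f').1 = f.1 + f'.1 := rfl

theorem smul_val {X Y : EquivObj a} (r : F) (f : X ⟶ Y) : (r • f).1 = r • f.1 := rfl

theorem toIterated_map_val {X Y : EquivObj a} (f : X ⟶ Y) :
    ((toIterated hg).map f).1 = (res a i).map f := rfl

instance : (res a i).Additive where
  map_add := hom_ext rfl

instance : (res a i).Linear F where
  map_smul _ _ := hom_ext rfl

instance : (toIterated hg).Faithful where
  map_injective h := hom_ext (congrArg (fun f => f.1.1) h)

instance : (toIterated hg).Full where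
  map_surjective {X Y} f := by
    have h : f.1.1 ∈ homs X Y := fun Λ _ _ q => by
      rw [← assembleα_descend_lift hg, ← assembleα_descend_lift hg]
      exact (mem_homs_iff_assembleα g f.1).1 f.2 Λ q
    refine ⟨⟨f.1.1, h⟩, hom_ext ?_⟩
    rw [toIterated_map_val]
    exact hom_ext rfl

instance : (toIterated hg).EssSurj where
  mem_essImage W := ⟨assemble g ((res b p).obj W), ⟨toIteratedAssembleIso hg W⟩⟩

instance : (toIterated hg).IsEquivalence where

instance : (toIterated hg).Additive where
  map_add {X Y f f'} := hom_ext <| by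
    rw [toIterated_map_val, add_val, toIterated_map_val, toIterated_map_val]
    exact Functor.map_add _

instance : (toIterated hg).Linear F where
  map_smul {X Y} f r := hom_ext <| by
    rw [toIterated_map_val, smul_val, toIterated_map_val]
    exact Functor.map_smul _ _ _

/-- The composite of `toIterated` with the forgetful functor is the restriction functor. -/
def toIteratedForgetIso : toIterated hg ⋙ forget b ≅ res a i :=
  NatIso.ofComponents (fun X => Iso.refl ((res a i).obj X)) fun _ =>
    (Category.comp_id _).trans (Category.id_comp _).symm

end EquivObj

end Main

end ProAlg

end

theorem mainTheorem4 {F : Type u} [Field F] [CharZero F]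
    {A' A A'' : Type u} [CommRing A'] [HopfAlgebra F A'] [CommRing A] [HopfAlgebra F A]
    [CommRing A''] [HopfAlgebra F A'']
    {i : A →ₐc[F] A'} {p : A'' →ₐc[F] A} (hex : ProAlg.IsShortExact i p)
    {C : Type w} [Category.{v} C] [Preadditive C] [Linear F C]
    (a : ProAlg.AlgAction F A C)
    (b : ProAlg.AlgAction F A'' (ProAlg.EquivObj (a.res i)))
    (g : ProAlg.InducedActionIso hex a (b.res p)) (hg : g.ExtendsTrivialization) :
    ∃ (e : ProAlg.EquivObj a ≌ ProAlg.EquivObj b)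
      (η : e.functor ⋙ ProAlg.EquivObj.forget b ≅ ProAlg.EquivObj.res a i),
      e.functor.Additive ∧ e.functor.Linear F ∧
      ∀ (X : ProAlg.EquivObj a) (Λ : Type u) [CommRing Λ] [Algebra F Λ] (q : ProAlg.Pts F A Λ),
        (a.act q).map (ProAlg.ScalarExt.tmul 1 (η.hom.app X).1) ≫ (X.α q).hom =
          ((g.γ q).hom.app ⟨(e.functor.obj X).obj⟩).1 ≫
            ProAlg.EquivObj.inclHom ((e.functor.obj X).α (ProAlg.Pts.pull p q)).hom ≫
              ProAlg.ScalarExt.tmul 1 (η.hom.app X).1 := by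
  refine ⟨(ProAlg.EquivObj.toIterated hg).asEquivalence,
    ProAlg.EquivObj.toIteratedForgetIso hg,
    inferInstanceAs (ProAlg.EquivObj.toIterated hg).Additive,
    inferInstanceAs ((ProAlg.EquivObj.toIterated hg).Linear F), fun X Λ _ _ q => ?_⟩
  -- The components of `η` are identities, so the claim reduces to `assembleα_descend_lift`.
  refine (congrArg (· ≫ _) ((a.act q).map_id _)).trans ?_
  refine (Category.id_comp _).trans ?_
  refine (ProAlg.EquivObj.assembleα_descend_lift hg X q).symm.trans ?_
  exact congrArg (_ ≫ ·) (Category.comp_id _).symm
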